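/- Let $G=\mathrm{PGL}(d+1,\mathbb C)$ and let $Q\subset G$ be the maximal parabolic subgroup fixing the point $[1:0:\dots:0]\in\mathbb{CP}^d$, with Lie algebras $\mathfrak g=\mathfrak{sl}(d+1,\mathbb C)$ and $\mathfrak h=\{a\in\mathfrak g : a_{i1}=0 \text{ for } i\ge 2\}$. A *branched holomorphic projective structure* on a complex manifold $X$ of dimension $d$ is a pair $(E_H,\theta)$, where $E_H$ is a holomorphic principal $Q$-bundle on $X$ and $\theta:\mathrm{At}(E_H)\to \mathrm{ad}(E_G)$, $E_G=E_H\times^{Q}G$, is a holomorphic homomorphism of vector bundles from the Atiyah bundle $\mathrm{At}(E_H)=(TE_H)/Q$ that restricts to the natural inclusion $\mathrm{ad}(E_H)\hookrightarrow\mathrm{ad}(E_G)$ and is an isomorphism over a nonempty open subset of $X$. It induces a holomorphic connection $\theta'$ on $E_G$, namely the map from $\mathrm{At}(E_G)=(\mathrm{At}(E_H)\oplus\mathrm{ad}(E_G))/\mathrm{ad}(E_H)$ to $\mathrm{ad}(E_G)$ given by $(v,w)\mapsto\theta(v)+w$. The structure is *normal* if $\mathrm{Curv}(\theta')\in H^0(X,\mathrm{ad}(E_H)\otimes\Omega^2_X)$,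 and *flat* if $\mathrm{Curv}(\theta')=0$. The genus of a compact connected Riemann surface $Y$ is $\dim H^0(Y,\Omega^1_Y)$. **Proposition.** 1. There exist a compact connected complex surface $X$ and a branched holomorphic projective structure on $X$ that is normal but not flat. 2. More precisely, compact connected Riemann surfaces of genus at least two exist. If $Y$ is any such surface, then there are linearly independent $\alpha_1,\alpha_2\in H^0(Y,\Omega^1_Y)$, and for every linearly independent pair $\alpha_1,\alpha_2$ the following holds. Put $X=Y\times Y$ with projections $p_1,p_2:X\to Y$, let $E_H=X\times Q$ be the trivial principal $Q$-bundle ($d=2$), and identify $\mathrm{At}(E_H)=(X\times\mathfrak h)\oplus TX$ and $\mathrm{ad}(E_G)=X\times\mathfrak g$ by means of the trivialization. Then $$\theta(w,v)=w+\begin{pmatrix}0&0&(p_1^*\alpha_1)(v)\\ (p_1^*\alpha_1)(v)&0&0\\ (p_2^*\alpha_2)(v)&0&0\end{pmatrix},\qquad w\in\mathfrak h,\ v\in TX,$$ defines a branched holomorphic projective structure $(E_H,\theta)$ on $X$, and this structure is normal but not flat. -/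

import Mathlib

open Set Matrix MatrixGroups Manifold
open scoped ContDiff LinearAlgebra.Projectivization

noncomputable section

namespace BranchedCartan

universe u

/-! ### The model `G/H = PGL(d+1, ℂ)/Q` -/

section Model

variable (d : ℕ)

/-- The point `[1 : 0 : ⋯ : 0]` of `ℂP^d`. -/
def basePoint : ℙ ℂ (Fin (d + 1) → ℂ) :=
  Projectivization.mk ℂ (Pi.single 0 1 : Fin (d + 1) → ℂ) (by simp)

/-- The maximal parabolic subgroup `Q ⊂ PGL(d+1, ℂ)`: the stabilizer of `[1 : 0 : ⋯ : 0]` for the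
standard action on `ℂP^d`. -/
def parabolic : Subgroup PGL(Fin (d + 1), ℂ) := MulAction.stabilizer _ (basePoint d)

/-- The Lie algebra `𝔤` of `PGL(d+1, ℂ)`: trace-free matrices. -/
def gAlg : Submodule ℂ (Matrix (Fin (d + 1)) (Fin (d + 1)) ℂ) :=
  LinearMap.ker (Matrix.traceLinearMap (Fin (d + 1)) ℂ ℂ)

/-- The Lie algebra `𝔥` of `Q`: trace-free matrices whose first column is zero below the
diagonal. -/
def hAlg : Submodule ℂ (Matrix (Fin (d + 1)) (Fin (d + 1)) ℂ) where
  carrier := {a | a.trace = 0 ∧ ∀ i, i ≠ 0 → a i 0 = 0}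
  add_mem' := by
    rintro a b ⟨ha, ha'⟩ ⟨hb, hb'⟩
    exact ⟨by rw [Matrix.trace_add, ha, hb, add_zero], fun i hi => by simp [ha' i hi, hb' i hi]⟩
  zero_mem' := ⟨by simp, by simp⟩
  smul_mem' := by
    rintro c a ⟨ha, ha'⟩
    exact ⟨by rw [Matrix.trace_smul, ha, smul_zero], fun i hi => by simp [ha' i hi]⟩

variable {d}

lemma mem_gAlg {a : Matrix (Fin (d + 1)) (Fin (d + 1)) ℂ} : a ∈ gAlg d ↔ a.trace = 0 :=
  LinearMap.mem_ker

lemma mem_hAlg {a : Matrix (Fin (d + 1)) (Fin (d + 1)) ℂ} :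
    a ∈ hAlg d ↔ a.trace = 0 ∧ ∀ i, i ≠ 0 → a i 0 = 0 := Iff.rfl

/-- Every element of `Q` is the class of exactly one invertible matrix whose first column is
`(1, 0, …, 0)`. -/
lemma exists_unique_lift (q : parabolic d) :
    ∃! A : GL (Fin (d + 1)) ℂ, Matrix.ProjGenLinGroup.mk A = (q : PGL(Fin (d + 1), ℂ)) ∧
      ∀ i, (A : Matrix (Fin (d + 1)) (Fin (d + 1)) ℂ) i 0 = if i = 0 then 1 else 0 := by
  obtain ⟨q, hq⟩ := q
  obtain ⟨B, rfl⟩ := Matrix.ProjGenLinGroup.mk_surjective q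
  have h1 : (Matrix.ProjGenLinGroup.mk B : PGL(Fin (d + 1), ℂ)) • basePoint d = basePoint d := hq
  rw [basePoint, Projectivization.PGL.mk_smul_mk, Projectivization.mk_eq_mk_iff] at h1
  obtain ⟨u, hu⟩ := h1
  have h2 : ∀ i, (B : Matrix (Fin (d + 1)) (Fin (d + 1)) ℂ) i 0
      = if i = 0 then (u : ℂ) else 0 := by
    intro i
    have h3 := congrFun hu i
    have h4 : (B • (Pi.single 0 1 : Fin (d + 1) → ℂ)) i
        = (B : Matrix (Fin (d + 1)) (Fin (d + 1)) ℂ) i 0 := by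
      change ((B : Matrix (Fin (d + 1)) (Fin (d + 1)) ℂ) *ᵥ (Pi.single 0 1)) i = _
      simp
    rw [h4] at h3
    rw [← h3]
    by_cases hi : i = 0
    · subst hi; simp [Units.smul_def]
    · simp [hi]
  refine ⟨B * Matrix.GeneralLinearGroup.scalar _ u⁻¹, ⟨?_, ?_⟩, ?_⟩
  · simp
  · intro i
    simp only [Units.val_mul, Matrix.GeneralLinearGroup.coe_scalar]
    simp only [Matrix.scalar_apply, Matrix.mul_diagonal, h2 i]
    by_cases hi : i = 0 <;> simp [hi]
  · rintro C ⟨hC, hC'⟩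
    obtain ⟨v, rfl⟩ := Matrix.ProjGenLinGroup.mk_eq_mk_iff.1 hC.symm
    have h5 := hC' 0
    simp only [Units.val_mul, Matrix.GeneralLinearGroup.coe_scalar, Matrix.scalar_apply,
      Matrix.mul_diagonal, h2 0, if_true] at h5
    have h6 : u * v = 1 := Units.ext h5
    rw [eq_inv_of_mul_eq_one_right h6]

/-- The matrix representing `q ∈ Q` whose first column is `(1, 0, …, 0)`. Taking it identifies the
complex Lie group `Q` with a closed subgroup of `GL(d+1, ℂ)`. -/
def lift (q : parabolic d) : GL (Fin (d + 1)) ℂ := (exists_unique_lift q).choose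

lemma mk_lift (q : parabolic d) : Matrix.ProjGenLinGroup.mk (lift q) = (q : PGL(Fin (d + 1), ℂ)) :=
  (exists_unique_lift q).choose_spec.1.1

lemma lift_col (q : parabolic d) (i : Fin (d + 1)) :
    (lift q : Matrix (Fin (d + 1)) (Fin (d + 1)) ℂ) i 0 = if i = 0 then 1 else 0 :=
  (exists_unique_lift q).choose_spec.1.2 i

lemma lift_one : lift (1 : parabolic d) = 1 :=
  ((exists_unique_lift (1 : parabolic d)).choose_spec.2 1
    ⟨by simp, fun i => by simp [Matrix.one_apply]⟩).symm

lemma lift_inv_col (q : parabolic d) (i : Fin (d + 1)) :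
    ((lift q)⁻¹ : GL (Fin (d + 1)) ℂ).val i 0 = if i = 0 then 1 else 0 := by
  have h : ((lift q)⁻¹ : GL (Fin (d + 1)) ℂ).val * (lift q).val = 1 := by
    rw [← Units.val_mul]; simp
  have h1 := congrFun (congrFun h i) 0
  rw [Matrix.mul_apply] at h1
  simpa [lift_col, Matrix.one_apply] using h1

/-- `Ad(q⁻¹)` on matrices, `a ↦ q⁻¹ a q`. Central elements act trivially, so that the choice of the
representing matrix does not matter. -/
def conj (q : parabolic d) (a : Matrix (Fin (d + 1)) (Fin (d + 1)) ℂ) :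
    Matrix (Fin (d + 1)) (Fin (d + 1)) ℂ :=
  ((lift q)⁻¹ : GL (Fin (d + 1)) ℂ).val * a * (lift q).val

lemma trace_conj (q : parabolic d) (a : Matrix (Fin (d + 1)) (Fin (d + 1)) ℂ) :
    (conj q a).trace = a.trace := by
  rw [conj, Matrix.trace_mul_comm, ← Matrix.mul_assoc, ← Units.val_mul]
  simp

lemma conj_mem_hAlg (q : parabolic d) {a : Matrix (Fin (d + 1)) (Fin (d + 1)) ℂ}
    (ha : a ∈ hAlg d) : conj q a ∈ hAlg d := by
  refine ⟨by rw [trace_conj, ha.1], fun i hi => ?_⟩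
  have h1 : ∀ j, (a * (lift q).val) j 0 = a j 0 := by
    intro j; simp [Matrix.mul_apply, lift_col]
  rw [conj, Matrix.mul_assoc, Matrix.mul_apply, Finset.sum_eq_single 0]
  · rw [h1, lift_inv_col, if_neg hi, zero_mul]
  · intro j _ hj
    rw [h1, ha.2 j hj, mul_zero]
  · simp

/-- `Ad(q⁻¹)` on `𝔤`. -/
def adG (q : parabolic d) : gAlg d →ₗ[ℂ] gAlg d where
  toFun a := ⟨conj q a, mem_gAlg.2 ((trace_conj q _).trans (mem_gAlg.1 a.2))⟩
  map_add' a b := Subtype.ext (by simp [conj, Matrix.mul_add, Matrix.add_mul])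
  map_smul' c a := Subtype.ext (by simp [conj])

/-- `Ad(q⁻¹)` on `𝔥`. -/
def adH (q : parabolic d) : hAlg d →ₗ[ℂ] hAlg d where
  toFun a := ⟨conj q a, conj_mem_hAlg q a.2⟩
  map_add' a b := Subtype.ext (by simp [conj, Matrix.mul_add, Matrix.add_mul])
  map_smul' c a := Subtype.ext (by simp [conj])

/-- The inclusion `𝔥 ⊂ 𝔤`. -/
def inclHG : hAlg d →ₗ[ℂ] gAlg d where
  toFun a := ⟨a, mem_gAlg.2 a.2.1⟩
  map_add' _ _ := rfl
  map_smul' _ _ := rfl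

end Model

/-! ### Holomorphic objects on a complex manifold -/

section Manifold

variable {E H : Type*} [NormedAddCommGroup E] [NormedSpace ℂ E] [TopologicalSpace H]
  (I : ModelWithCorners ℂ E H) {X : Type u} [TopologicalSpace X] [ChartedSpace H X]

/-- For a function `α` on tangent vectors of `X`, the coefficient of `α` in the chart at `x₀` in the
coordinate direction `v`: the function `y ↦ α_{φ⁻¹(y)}(dφ⁻¹(v))`, `φ` being that chart. -/
def chartCoeff (α : ∀ x : X, TangentSpace I x → ℂ) (x₀ : X) (v : E) : E → ℂ := fun y =>
  α ((extChartAt I x₀).symm y) (mfderiv 𝓘(ℂ, E) I (extChartAt I x₀).symm y v)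

/-- The function `α` on tangent vectors is holomorphic over the open set `U`: in all charts its
coefficients are holomorphic. -/
def IsHolFormOn (α : ∀ x : X, TangentSpace I x → ℂ) (U : Set X) : Prop :=
  ∀ (x₀ : X) (v : E), DifferentiableOn ℂ (chartCoeff I α x₀ v)
    ((extChartAt I x₀).target ∩ (extChartAt I x₀).symm ⁻¹' U)

/-- The exterior derivative at `x` of a scalar `1`-form `α`: in the chart `φ` at `x`, it is
`(u, v) ↦ ∂_u (α(v)) - ∂_v (α(u))`. -/
def extDerivForm (α : ∀ x : X, TangentSpace I x → ℂ) (x : X) (u v : TangentSpace I x) : ℂ :=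
  let φ := extChartAt I x
  let u' : E := mfderiv I 𝓘(ℂ, E) φ x u
  let v' : E := mfderiv I 𝓘(ℂ, E) φ x v
  fderiv ℂ (chartCoeff I α x v') (φ x) u' - fderiv ℂ (chartCoeff I α x u') (φ x) v'

variable (X) in
/-- The space `H⁰(X, Ω¹)` of holomorphic `1`-forms. -/
def holOneForms : Submodule ℂ (∀ x : X, TangentSpace I x →ₗ[ℂ] ℂ) where
  carrier := {α | IsHolFormOn I (fun x v => α x v) univ}
  add_mem' := fun hα hβ x₀ v => (hα x₀ v).add (hβ x₀ v)
  zero_mem' := fun _ _ => differentiableOn_const (0 : ℂ)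
  smul_mem' := fun c _ hα x₀ v => (hα x₀ v).const_smul c

variable {d : ℕ}

/-- A map into `Q` is holomorphic on `U`. -/
def IsHolGroupMapOn (g : X → parabolic d) (U : Set X) : Prop :=
  ∀ a b, MDifferentiableOn I 𝓘(ℂ, ℂ)
    (fun x => (lift (g x) : Matrix (Fin (d + 1)) (Fin (d + 1)) ℂ) a b) U

/-- The differential at `x` of the matrix-valued function `lift ∘ g`. -/
def dLift (g : X → parabolic d) (x : X) :
    TangentSpace I x →ₗ[ℂ] Matrix (Fin (d + 1)) (Fin (d + 1)) ℂ where
  toFun v := Matrix.of fun a b =>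
    (mfderiv I 𝓘(ℂ, ℂ) (fun y => (lift (g y) : Matrix (Fin (d + 1)) (Fin (d + 1)) ℂ) a b) x v : ℂ)
  map_add' v w := by ext a b; simp only [Matrix.add_apply, map_add]; rfl
  map_smul' c v := by
    ext a b; simp only [Matrix.smul_apply, map_smul, RingHom.id_apply]; rfl

lemma dLift_col (g : X → parabolic d) (x : X) (v : TangentSpace I x) (i : Fin (d + 1)) :
    dLift I g x v i 0 = 0 := by
  have h : (fun y => (lift (g y) : Matrix (Fin (d + 1)) (Fin (d + 1)) ℂ) i 0)
      = fun _ => if i = 0 then (1 : ℂ) else 0 := by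
    funext y; exact lift_col _ _
  change (mfderiv I 𝓘(ℂ, ℂ)
    (fun y => (lift (g y) : Matrix (Fin (d + 1)) (Fin (d + 1)) ℂ) i 0) x v : ℂ) = 0
  rw [h, mfderiv_const]
  rfl

/-- The projection of `𝔤𝔩(d+1, ℂ)` onto trace-free matrices along the scalar ones; it identifies
`𝔤𝔩(d+1, ℂ)/ℂ`, the Lie algebra of `PGL(d+1, ℂ)`, with trace-free matrices. -/
def traceFree : Matrix (Fin (d + 1)) (Fin (d + 1)) ℂ →ₗ[ℂ] Matrix (Fin (d + 1)) (Fin (d + 1)) ℂ where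
  toFun a := a - (a.trace / (d + 1)) • (1 : Matrix (Fin (d + 1)) (Fin (d + 1)) ℂ)
  map_add' a b := by rw [Matrix.trace_add, add_div, add_smul]; abel
  map_smul' c a := by
    rw [Matrix.trace_smul, smul_eq_mul, mul_div_assoc, mul_smul, RingHom.id_apply, smul_sub]

/-- The pull-back `g⁻¹ dg` of the Maurer-Cartan form of `Q` along `g : X → Q`. -/
def maurerCartan (g : X → parabolic d) (x : X) : TangentSpace I x →ₗ[ℂ] hAlg d where
  toFun v := ⟨traceFree (((lift (g x))⁻¹ : GL (Fin (d + 1)) ℂ).val * dLift I g x v), by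
    constructor
    · have : ((d : ℂ) + 1) ≠ 0 := by exact_mod_cast Nat.succ_ne_zero d
      simp [traceFree, Matrix.trace_sub, this]
    · intro i hi
      simp [traceFree, Matrix.mul_apply, dLift_col, hi]⟩
  map_add' v w := Subtype.ext (by simp [Matrix.mul_add])
  map_smul' c v := Subtype.ext (by simp)

variable (d) (X) in
/-- A holomorphic principal `Q`-bundle on `X`, `Q ⊂ PGL(d+1, ℂ)` the parabolic subgroup: a space
with a right action of `Q` that is simply transitive on the fibres of the projection to `X`, with an
atlas of local sections (equivalently, local trivializations `U i × Q ≅ proj⁻¹ (U i)`,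
`(x, q) ↦ s i x · q`) whose transition functions are holomorphic. The atlas defines the complex
structure of the total space. -/
structure PrincipalBundle where
  /-- total space -/
  Tot : Type u
  /-- right action of `Q` -/
  [act : MulAction (parabolic d)ᵐᵒᵖ Tot]
  proj : Tot → X
  proj_smul : ∀ (q : parabolic d) (p : Tot), proj (MulOpposite.op q • p) = proj p
  simply_transitive : ∀ p p' : Tot, proj p = proj p' →
    ∃! q : parabolic d, p' = MulOpposite.op q • p
  /-- index set of the atlas of local sections -/
  ι : Type u
  U : ι → Set X
  isOpen_U : ∀ i, IsOpen (U i)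
  cover : ∀ x, ∃ i, x ∈ U i
  /-- the section over `U i`; its values outside `U i` are irrelevant -/
  s : ι → X → Tot
  proj_s : ∀ i, ∀ x ∈ U i, proj (s i x) = x
  /-- the transition functions, `s j = s i · g i j` -/
  g : ι → ι → X → parabolic d
  s_eq : ∀ i j, ∀ x ∈ U i ∩ U j, s j x = MulOpposite.op (g i j x) • s i x
  holomorphic_g : ∀ i j, IsHolGroupMapOn I (g i j) (U i ∩ U j)

attribute [instance] PrincipalBundle.act

variable {I} in
/-- The change of trivialization of the Atiyah bundle `At(P) = (TP)/Q`. The section `s i` identifies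
`At(P)` over `U i` with `𝔥 ⊕ TX`, where `(w, v)` is the class of the tangent vector
`ds_i(v) + ζ_w` at `s i x`, `ζ_w` being the fundamental vector field of `w`; replacing `s i` by
`s j = s i · g` sends `(w, v)` to `(Ad(g⁻¹)w - (g⁻¹dg)(v), v)`. -/
def atiyahChange (P : PrincipalBundle I X d) (i j : P.ι) (x : X) :
    (hAlg d × TangentSpace I x) →ₗ[ℂ] (hAlg d × TangentSpace I x) :=
  LinearMap.prod
    ((adH (P.g i j x)).comp (LinearMap.fst ℂ _ _)
      - (maurerCartan I (P.g i j) x).comp (LinearMap.snd ℂ _ _))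
    (LinearMap.snd ℂ _ _)

/-- A branched holomorphic Cartan geometry of type `PGL(d+1, ℂ)/Q` whose underlying principal
`Q`-bundle is `P`: a holomorphic homomorphism `θ : At(P) → ad(P ×^Q G)` that restricts to the
inclusion `ad(P) → ad(P ×^Q G)` and is an isomorphism over a nonempty open subset of `X`. The
section `s i` identifies `At(P)` with `𝔥 ⊕ TX` and `ad(P ×^Q G)` with `X × 𝔤` over `U i`, and
`θ i x : 𝔥 ⊕ T_xX → 𝔤` is the expression of `θ` in these trivializations. -/
structure BranchedGeometry (P : PrincipalBundle I X d) where
  /-- the expression of `θ` over `U i`; its values outside `U i` are irrelevant -/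
  θ : ∀ _ : P.ι, ∀ x : X, (hAlg d × TangentSpace I x) →ₗ[ℂ] gAlg d
  /-- the local expressions glue to a homomorphism of vector bundles -/
  compatible : ∀ i j, ∀ x ∈ P.U i ∩ P.U j, ∀ z,
    θ j x (atiyahChange P i j x z) = adG (P.g i j x) (θ i x z)
  /-- the homomorphism is holomorphic -/
  holomorphic : ∀ i (w : hAlg d) a b, IsHolFormOn I
    (fun x v => (θ i x (w, v) : Matrix (Fin (d + 1)) (Fin (d + 1)) ℂ) a b) (P.U i)
  /-- it restricts to the inclusion of `ad(P)` -/
  restrict : ∀ i, ∀ x ∈ P.U i, ∀ w, θ i x (w, 0) = inclHG w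
  /-- it is an isomorphism over a nonempty open subset -/
  iso : ∃ V : Set X, IsOpen V ∧ V.Nonempty ∧
    ∀ i, ∀ x ∈ V ∩ P.U i, Function.Bijective (θ i x)

namespace BranchedGeometry

variable {I} {P : PrincipalBundle I X d} (Θ : BranchedGeometry I P)

/-- The connection `1`-form, in the section `s i`, of the holomorphic connection `θ'` induced by `θ`
on the principal `G`-bundle `P ×^Q G`. As `θ'` sends the class of `(z, b) ∈ At(P) ⊕ ad(P ×^Q G)` to
`θ(z) + b`, it is `v ↦ θ(ds_i(v))`. -/
def connForm (i : P.ι) (x : X) (v : TangentSpace I x) :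
    Matrix (Fin (d + 1)) (Fin (d + 1)) ℂ :=
  (Θ.θ i x (0, v) : Matrix (Fin (d + 1)) (Fin (d + 1)) ℂ)

/-- The curvature `Curv(θ') ∈ H⁰(X, ad(P ×^Q G) ⊗ Ω²)` of `θ'` over `U i`, in the trivialization
given by `s i`: with the connection form `A`, it is `(u, v) ↦ dA(u, v) + [A(u), A(v)]`, that
is `dA + A ∧ A`. -/
def curvature (i : P.ι) (x : X) (u v : TangentSpace I x) :
    Matrix (Fin (d + 1)) (Fin (d + 1)) ℂ :=
  Matrix.of (fun a b => extDerivForm I (fun y w => Θ.connForm i y w a b) x u v)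
    + (Θ.connForm i x u * Θ.connForm i x v - Θ.connForm i x v * Θ.connForm i x u)

/-- The geometry is normal: its curvature has values in `ad(P)`. -/
def IsNormal : Prop := ∀ i, ∀ x ∈ P.U i, ∀ u v, Θ.curvature i x u v ∈ hAlg d

/-- The geometry is flat: its curvature vanishes. -/
def IsFlat : Prop := ∀ i, ∀ x ∈ P.U i, ∀ u v, Θ.curvature i x u v = 0

end BranchedGeometry

variable (d) (X) in
/-- A branched holomorphic projective structure on a complex manifold `X` of dimension `d`: a
branched holomorphic Cartan geometry of type `PGL(d+1, ℂ)/Q`. -/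
structure BranchedProjectiveStructure where
  bundle : PrincipalBundle I X d
  geometry : BranchedGeometry I bundle

variable (d) (X) in
/-- The trivial holomorphic principal `Q`-bundle `X × Q`, with the section `x ↦ (x, 1)`. -/
def trivialBundle : PrincipalBundle I X d where
  Tot := X × parabolic d
  act :=
    { smul := fun q p => (p.1, p.2 * q.unop)
      one_smul := fun p => Prod.ext rfl (mul_one p.2)
      mul_smul := fun q r p => Prod.ext rfl (mul_assoc p.2 r.unop q.unop).symm }
  proj := Prod.fst
  proj_smul _ _ := rfl
  simply_transitive := by
    rintro ⟨x, p⟩ ⟨x', p'⟩ h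
    obtain rfl : x = x' := h
    refine ⟨p⁻¹ * p', Prod.ext rfl (mul_inv_cancel_left p p').symm, ?_⟩
    intro q hq
    have h2 : p' = p * q := congrArg Prod.snd hq
    rw [h2, inv_mul_cancel_left]
  ι := PUnit
  U _ := univ
  isOpen_U _ := isOpen_univ
  cover _ := ⟨PUnit.unit, mem_univ _⟩
  s _ x := (x, 1)
  proj_s _ _ _ := rfl
  g _ _ _ := 1
  s_eq _ _ _ _ := Prod.ext rfl (mul_one 1).symm
  holomorphic_g _ _ _ _ := mdifferentiableOn_const

end Manifold

/-! ### Curves and the form on `Y × Y` -/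

section Curves

variable (Y : Type u) [TopologicalSpace Y] [ChartedSpace ℂ Y]

/-- The genus of a compact Riemann surface, the dimension of the space of holomorphic `1`-forms. -/
def genus : Cardinal := Module.rank ℂ (holOneForms 𝓘(ℂ, ℂ) Y)

variable {Y}

/-- The value on a tangent vector `v` of `Y × Y` of the matrix of `1`-forms with entries
`p₁^*α₁` at the places `(1,3)` and `(2,1)`, `p₂^*α₂` at the place `(3,1)`, and zero elsewhere;
`p₁, p₂ : Y × Y → Y` are the projections. -/
def productForm (α₁ α₂ : ∀ y : Y, TangentSpace 𝓘(ℂ, ℂ) y →ₗ[ℂ] ℂ) (x : Y × Y)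
    (v : TangentSpace (𝓘(ℂ, ℂ).prod 𝓘(ℂ, ℂ)) x) : Matrix (Fin 3) (Fin 3) ℂ :=
  let a₁ : ℂ := α₁ x.1 (mfderiv (𝓘(ℂ, ℂ).prod 𝓘(ℂ, ℂ)) 𝓘(ℂ, ℂ) Prod.fst x v)
  let a₂ : ℂ := α₂ x.2 (mfderiv (𝓘(ℂ, ℂ).prod 𝓘(ℂ, ℂ)) 𝓘(ℂ, ℂ) Prod.snd x v)
  !![0, 0, a₁; a₁, 0, 0; a₂, 0, 0]

end Curves

end BranchedCartan

end

/-!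
On `X = Y × Y` the homomorphism `θ(w, v) = w + A(v)` has connection form `A`, whose entries are
pull-backs of holomorphic one-forms from curves. Such forms are closed (`extDerivForm_eq_zero`),
so the curvature is the commutator `[A(u), A(v)]`, which is `(p₁^*α₁ ∧ p₂^*α₂)(u, v)` times the
constant diagonal matrix with entries `1, 0, -1` (`productGeometry_curvature`). That matrix lies
in `𝔥`, so the structure is normal, and it is not flat because `α₁` and `α₂` do not vanish
identically. Where neither `α₁(x₁)` nor `α₂(x₂)` vanishes, the first column of `A` identifies
`T_xX` with `𝔤/𝔥`, so `θ` is an isomorphism there (`productTheta_bijective`).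

A curve of genus at least two is needed. It is the curve `y³ (x³ - 1) = x³ + 1` of bidegree
`(3, 3)` in `ℂP¹ × ℂP¹`, written as `M(x³) = y³` with the Möbius involution
`M(w) = (w + 1)/(w - 1)` and `ℂP¹` as `OnePoint ℂ`; as a closed subset it is compact and
Hausdorff. The projection to `x` is open, being a base change of the cube map, and closed; the
fibre over `x = -1` is a single point, and so the curve is connected. The involutions
`(x, y) ↦ (1/x, -y)` and `(x, y) ↦ (y, x)` preserve the curve, and they move every point to the
part where `x` is finite and `y` is neither `0` nor `∞` (`exists_curveSymm_eq_coe`). There `x` is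
a local coordinate, because `y` is a branch of a cube root (`exists_affine_chart`); this gives
four types of charts. The form `ω = dx/(y² (x³ - 1))` is holomorphic in charts of the first type,
`(x, y) ↦ (1/x, -y)` pulls it back to `x ω`, and `(x, y) ↦ (y, x)` to `-ω`. Hence `ω` and `x ω`
are, in each type of chart with coordinates `(a, b)`, polynomials in `a` and `b` times
`da/(b² (a³ - 1))`, and are holomorphic everywhere (`IsCurveChart.exists_hasDerivAt_transition`).
They are independent since `x` is not constant.
-/

noncomputable section

namespace BranchedCartan

universe u

/-! ### The geometry on a product of two copies of a curve -/

section Product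

variable {Y : Type u} [TopologicalSpace Y] [ChartedSpace ℂ Y]

lemma linearMap_apply_eq_mul (L : ℂ →ₗ[ℂ] ℂ) (v : ℂ) : L v = v * L 1 := by
  rw [← smul_eq_mul, ← map_smul, smul_eq_mul, mul_one]

lemma form_apply_eq_mul (α : ∀ y : Y, TangentSpace 𝓘(ℂ, ℂ) y →ₗ[ℂ] ℂ) (y : Y) (v : ℂ) :
    α y v = v * α y (1 : ℂ) :=
  linearMap_apply_eq_mul (α y : ℂ →ₗ[ℂ] ℂ) v

lemma chartCoeff_eq_mul (α : ∀ y : Y, TangentSpace 𝓘(ℂ, ℂ) y →ₗ[ℂ] ℂ) (y₀ : Y) (v z : ℂ) :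
    chartCoeff 𝓘(ℂ, ℂ) (fun y v => α y v) y₀ v z
      = v * chartCoeff 𝓘(ℂ, ℂ) (fun y v => α y v) y₀ 1 z := by
  let L : ℂ →L[ℂ] ℂ := mfderiv 𝓘(ℂ, ℂ) 𝓘(ℂ, ℂ) (extChartAt 𝓘(ℂ, ℂ) y₀).symm z
  exact linearMap_apply_eq_mul
    ((α ((extChartAt 𝓘(ℂ, ℂ) y₀).symm z) : ℂ →ₗ[ℂ] ℂ).comp (L : ℂ →ₗ[ℂ] ℂ)) v

lemma exists_apply_one_ne_zero {α : ∀ y : Y, TangentSpace 𝓘(ℂ, ℂ) y →ₗ[ℂ] ℂ} (h : α ≠ 0) :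
    ∃ y, α y (1 : ℂ) ≠ 0 := by
  by_contra! hc
  refine h (funext fun y => LinearMap.ext fun v => ?_)
  exact (form_apply_eq_mul α y v).trans ((congrArg _ (hc y)).trans (mul_zero (M₀ := ℂ) v))

lemma productForm_eq (α₁ α₂ : ∀ y : Y, TangentSpace 𝓘(ℂ, ℂ) y →ₗ[ℂ] ℂ) (x : Y × Y) (v : ℂ × ℂ) :
    productForm α₁ α₂ x v = !![0, 0, v.1 * α₁ x.1 (1 : ℂ); v.1 * α₁ x.1 (1 : ℂ), 0, 0;
      v.2 * α₂ x.2 (1 : ℂ), 0, 0] := by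
  rw [← form_apply_eq_mul, ← form_apply_eq_mul]
  simp only [productForm, mfderiv_fst, mfderiv_snd]
  rfl

/-- The matrix of one-forms `productForm`, as a linear map on each tangent space. -/
def productFormLinear (α₁ α₂ : ∀ y : Y, TangentSpace 𝓘(ℂ, ℂ) y →ₗ[ℂ] ℂ) (x : Y × Y) :
    TangentSpace (𝓘(ℂ, ℂ).prod 𝓘(ℂ, ℂ)) x →ₗ[ℂ] Matrix (Fin 3) (Fin 3) ℂ where
  toFun := productForm α₁ α₂ x
  map_add' v w := by
    simp only [productForm, map_add]
    ext i j
    fin_cases i <;> fin_cases j <;> simp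
  map_smul' c v := by
    simp only [productForm, map_smul]
    ext i j
    fin_cases i <;> fin_cases j <;> simp

lemma trace_productForm (α₁ α₂ : ∀ y : Y, TangentSpace 𝓘(ℂ, ℂ) y →ₗ[ℂ] ℂ) (x : Y × Y)
    (v : TangentSpace (𝓘(ℂ, ℂ).prod 𝓘(ℂ, ℂ)) x) : (productForm α₁ α₂ x v).trace = 0 := by
  simp [productForm, Matrix.trace_fin_three]

/-- The homomorphism `(w, v) ↦ w + A(v)` on the fibre over `x`, `A` the matrix `productForm`. -/
def productTheta (α₁ α₂ : ∀ y : Y, TangentSpace 𝓘(ℂ, ℂ) y →ₗ[ℂ] ℂ) (x : Y × Y) :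
    (hAlg 2 × TangentSpace (𝓘(ℂ, ℂ).prod 𝓘(ℂ, ℂ)) x) →ₗ[ℂ] gAlg 2 :=
  LinearMap.coprod inclHG
    ((productFormLinear α₁ α₂ x).codRestrict (gAlg 2)
      fun v => mem_gAlg.2 (trace_productForm α₁ α₂ x v))

lemma productTheta_apply (α₁ α₂ : ∀ y : Y, TangentSpace 𝓘(ℂ, ℂ) y →ₗ[ℂ] ℂ) (x : Y × Y)
    (w : hAlg 2) (v : TangentSpace (𝓘(ℂ, ℂ).prod 𝓘(ℂ, ℂ)) x) :
    (productTheta α₁ α₂ x (w, v) : Matrix (Fin 3) (Fin 3) ℂ) = w + productForm α₁ α₂ x v := by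
  simp [productTheta, LinearMap.coprod_apply, inclHG, productFormLinear]

/-- The first column of `b ∈ 𝔤` below the diagonal determines `v`, and then `w = b - A(v)`. -/
lemma productTheta_bijective {α₁ α₂ : ∀ y : Y, TangentSpace 𝓘(ℂ, ℂ) y →ₗ[ℂ] ℂ} {x : Y × Y}
    (h₁ : α₁ x.1 (1 : ℂ) ≠ 0) (h₂ : α₂ x.2 (1 : ℂ) ≠ 0) :
    Function.Bijective (productTheta α₁ α₂ x) := by
  constructor
  · rw [injective_iff_map_eq_zero]
    rintro ⟨w, v⟩ h
    have h' : (w : Matrix (Fin 3) (Fin 3) ℂ) + productForm α₁ α₂ x v = 0 := by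
      rw [← productTheta_apply, h]; rfl
    change ℂ × ℂ at v
    have hw := w.2.2
    rw [productForm_eq] at h'
    have e1 := congrFun (congrFun h' 1) 0
    have e2 := congrFun (congrFun h' 2) 0
    have hw1 : (w : Matrix (Fin 3) (Fin 3) ℂ) 1 0 = 0 := hw 1 (by decide)
    have hw2 : (w : Matrix (Fin 3) (Fin 3) ℂ) 2 0 = 0 := hw 2 (by decide)
    simp [hw1, h₁] at e1
    simp [hw2, h₂] at e2
    have hv : v = 0 := Prod.ext e1 e2
    subst hv
    have hw0 : w = 0 := by
      apply Subtype.ext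
      refine Eq.trans ?_ h'
      ext i j
      fin_cases i <;> fin_cases j <;> simp
    rw [hw0]
    rfl
  · intro b
    let v : ℂ × ℂ := ((b : Matrix (Fin 3) (Fin 3) ℂ) 1 0 / α₁ x.1 (1 : ℂ),
      (b : Matrix (Fin 3) (Fin 3) ℂ) 2 0 / α₂ x.2 (1 : ℂ))
    refine ⟨(⟨b - productForm α₁ α₂ x v, ?_, ?_⟩, v), ?_⟩
    · rw [Matrix.trace_sub, mem_gAlg.1 b.2, zero_sub, neg_eq_zero]
      exact trace_productForm α₁ α₂ x v
    · intro i hi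
      rw [productForm_eq]
      fin_cases i
      · exact absurd rfl hi
      · simp [v, h₁]
      · simp [v, h₂]
    · apply Subtype.ext
      exact (productTheta_apply α₁ α₂ x _ v).trans (sub_add_cancel _ _)

/-- A form whose coefficients are `ℓ(a) g(ℓ(z))` for a linear form `ℓ` is closed: it is the
pull-back of the one-form `g dζ` in one variable. -/
lemma extDerivForm_eq_zero {β : ∀ x : Y × Y, TangentSpace (𝓘(ℂ, ℂ).prod 𝓘(ℂ, ℂ)) x → ℂ}
    (x : Y × Y) (l : ℂ × ℂ →L[ℂ] ℂ) (g : ℂ → ℂ)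
    (hβ : ∀ a : ℂ × ℂ, ∀ z ∈ (extChartAt (𝓘(ℂ, ℂ).prod 𝓘(ℂ, ℂ)) x).target,
      chartCoeff (𝓘(ℂ, ℂ).prod 𝓘(ℂ, ℂ)) β x a z = l a * g (l z))
    (hg : DifferentiableAt ℂ g (l (extChartAt (𝓘(ℂ, ℂ).prod 𝓘(ℂ, ℂ)) x x)))
    (u v : TangentSpace (𝓘(ℂ, ℂ).prod 𝓘(ℂ, ℂ)) x) :
    extDerivForm (𝓘(ℂ, ℂ).prod 𝓘(ℂ, ℂ)) β x u v = 0 := by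
  set φ := extChartAt (𝓘(ℂ, ℂ).prod 𝓘(ℂ, ℂ)) x with hφ
  have hmem : φ x ∈ φ.target := mem_extChartAt_target x
  have hopen : IsOpen φ.target := isOpen_extChartAt_target x
  have key : ∀ a b : ℂ × ℂ, fderiv ℂ (chartCoeff (𝓘(ℂ, ℂ).prod 𝓘(ℂ, ℂ)) β x a) (φ x) b
      = l a * (l b * deriv g (l (φ x))) := by
    intro a b
    have he : chartCoeff (𝓘(ℂ, ℂ).prod 𝓘(ℂ, ℂ)) β x a =ᶠ[nhds (φ x)] fun z => l a * g (l z) := by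
      filter_upwards [hopen.mem_nhds hmem] with z hz using hβ a z hz
    have h1 := (HasFDerivAt.const_mul
      (hg.hasDerivAt.comp_hasFDerivAt (φ x) (l.hasFDerivAt)) (l a))
    rw [he.fderiv_eq]
    refine (DFunLike.congr_fun h1.fderiv b).trans ?_
    simp [mul_comm]
  let u' : ℂ × ℂ := mfderiv (𝓘(ℂ, ℂ).prod 𝓘(ℂ, ℂ)) 𝓘(ℂ, ℂ × ℂ) φ x u
  let v' : ℂ × ℂ := mfderiv (𝓘(ℂ, ℂ).prod 𝓘(ℂ, ℂ)) 𝓘(ℂ, ℂ × ℂ) φ x v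
  have h := congrArg₂ (· - ·) (key v' u') (key u' v')
  refine Eq.trans h ?_
  ring

variable [IsManifold 𝓘(ℂ, ℂ) ω Y]

lemma mdifferentiableAt_extChartAt_symm {E X : Type*} [NormedAddCommGroup E] [NormedSpace ℂ E]
    {H : Type*} [TopologicalSpace H] (I : ModelWithCorners ℂ E H) [I.Boundaryless]
    [TopologicalSpace X] [ChartedSpace H X] [IsManifold I 1 X] {x : X} {z : E}
    (hz : z ∈ (extChartAt I x).target) :
    MDifferentiableAt 𝓘(ℂ, E) I (extChartAt I x).symm z :=
  (mdifferentiableOn_extChartAt_symm z hz).mdifferentiableAt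
    ((isOpen_extChartAt_target x).mem_nhds hz)

lemma mfderiv_extChartAt_prod_symm (x₀ : Y × Y) {z : ℂ × ℂ}
    (hz : z ∈ (extChartAt (𝓘(ℂ, ℂ).prod 𝓘(ℂ, ℂ)) x₀).target) (v : ℂ × ℂ) :
    mfderiv 𝓘(ℂ, ℂ × ℂ) (𝓘(ℂ, ℂ).prod 𝓘(ℂ, ℂ))
        (extChartAt (𝓘(ℂ, ℂ).prod 𝓘(ℂ, ℂ)) x₀).symm z v
      = (mfderiv 𝓘(ℂ, ℂ) 𝓘(ℂ, ℂ) (extChartAt 𝓘(ℂ, ℂ) x₀.1).symm z.1 v.1,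
         mfderiv 𝓘(ℂ, ℂ) 𝓘(ℂ, ℂ) (extChartAt 𝓘(ℂ, ℂ) x₀.2).symm z.2 v.2) := by
  have : IsManifold 𝓘(ℂ, ℂ) 1 Y := IsManifold.of_le (n := ω) (by simp)
  have hz' := hz
  rw [extChartAt_prod, PartialEquiv.prod_target] at hz'
  have h := (mdifferentiableAt_extChartAt_symm 𝓘(ℂ, ℂ) hz'.1).prodMap
    (mdifferentiableAt_extChartAt_symm 𝓘(ℂ, ℂ) hz'.2)
  have h2 := mfderiv_prodMap (mdifferentiableAt_extChartAt_symm 𝓘(ℂ, ℂ) hz'.1)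
    (mdifferentiableAt_extChartAt_symm 𝓘(ℂ, ℂ) hz'.2)
  rw [extChartAt_prod, modelWithCornersSelf_prod, ← chartedSpaceSelf_prod]
  exact DFunLike.congr_fun h2 v

/-- In a chart at `y₀` the differential of the inverse chart is invertible, so that the zeros of `α`
are those of its coefficient, which is continuous. -/
lemma isOpen_ne_zero {α : ∀ y : Y, TangentSpace 𝓘(ℂ, ℂ) y →ₗ[ℂ] ℂ}
    (hα : α ∈ holOneForms 𝓘(ℂ, ℂ) Y) : IsOpen {y | α y (1 : ℂ) ≠ 0} := by
  have : IsManifold 𝓘(ℂ, ℂ) 1 Y := IsManifold.of_le (n := ω) (by simp)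
  rw [isOpen_iff_mem_nhds]
  intro y₀ hy₀
  have key : ∀ y ∈ (extChartAt 𝓘(ℂ, ℂ) y₀).source, (α y (1 : ℂ) ≠ 0 ↔
      chartCoeff 𝓘(ℂ, ℂ) (fun y v => α y v) y₀ 1 (extChartAt 𝓘(ℂ, ℂ) y₀ y) ≠ 0) := by
    intro y hy
    have hz := (extChartAt 𝓘(ℂ, ℂ) y₀).map_source hy
    have hinv := isInvertible_mfderivWithin_extChartAt_symm (I := 𝓘(ℂ, ℂ)) hz
    have hl := (extChartAt 𝓘(ℂ, ℂ) y₀).left_inv hy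
    simp only [ModelWithCorners.range_eq_univ, mfderivWithin_univ] at hinv
    simp only [chartCoeff]
    set p := (extChartAt 𝓘(ℂ, ℂ) y₀).symm (extChartAt 𝓘(ℂ, ℂ) y₀ y)
    let L : ℂ →L[ℂ] ℂ :=
      mfderiv 𝓘(ℂ, ℂ) 𝓘(ℂ, ℂ) (extChartAt 𝓘(ℂ, ℂ) y₀).symm (extChartAt 𝓘(ℂ, ℂ) y₀ y)
    have hL0 : L 1 ≠ 0 := fun h0 =>
      one_ne_zero (α := ℂ) (hinv.injective (h0.trans (map_zero L).symm))
    have e : α p (L 1) = L 1 * α p (1 : ℂ) := form_apply_eq_mul α p (L 1)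
    change _ ↔ α p (L 1) ≠ 0
    rw [e, hl]
    simp [hL0]
  have hcont : ContinuousAt (fun y => chartCoeff 𝓘(ℂ, ℂ) (fun y v => α y v) y₀ 1
      (extChartAt 𝓘(ℂ, ℂ) y₀ y)) y₀ := by
    have hd := hα y₀ 1
    simp only [preimage_univ, inter_univ] at hd
    have h1 := (hd.continuousOn.continuousAt
      ((isOpen_extChartAt_target y₀).mem_nhds (mem_extChartAt_target y₀)))
    exact ContinuousAt.comp (f := extChartAt 𝓘(ℂ, ℂ) y₀) h1 (continuousAt_extChartAt y₀)
  have h0 := (key y₀ (mem_extChartAt_source y₀)).1 hy₀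
  filter_upwards [hcont.eventually_ne h0, extChartAt_source_mem_nhds (I := 𝓘(ℂ, ℂ)) y₀]
    with y hy hys
  exact (key y hys).2 hy

/-- The coefficients of `p₁^*α` in a product chart are those of `α` in the chart of the factor. -/
lemma chartCoeff_fst (α : ∀ y : Y, TangentSpace 𝓘(ℂ, ℂ) y →ₗ[ℂ] ℂ) (x₀ : Y × Y) (v : ℂ × ℂ)
    {z : ℂ × ℂ} (hz : z ∈ (extChartAt (𝓘(ℂ, ℂ).prod 𝓘(ℂ, ℂ)) x₀).target) :
    chartCoeff (𝓘(ℂ, ℂ).prod 𝓘(ℂ, ℂ)) (fun (x : Y × Y) w => α x.1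
      (mfderiv (𝓘(ℂ, ℂ).prod 𝓘(ℂ, ℂ)) 𝓘(ℂ, ℂ) Prod.fst x w)) x₀ v z
      = v.1 * chartCoeff 𝓘(ℂ, ℂ) (fun y v => α y v) x₀.1 1 z.1 := by
  rw [← chartCoeff_eq_mul]
  simp only [chartCoeff]
  rw [mfderiv_fst, mfderiv_extChartAt_prod_symm x₀ hz]
  rfl

lemma chartCoeff_snd (α : ∀ y : Y, TangentSpace 𝓘(ℂ, ℂ) y →ₗ[ℂ] ℂ) (x₀ : Y × Y) (v : ℂ × ℂ)
    {z : ℂ × ℂ} (hz : z ∈ (extChartAt (𝓘(ℂ, ℂ).prod 𝓘(ℂ, ℂ)) x₀).target) :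
    chartCoeff (𝓘(ℂ, ℂ).prod 𝓘(ℂ, ℂ)) (fun (x : Y × Y) w => α x.2
      (mfderiv (𝓘(ℂ, ℂ).prod 𝓘(ℂ, ℂ)) 𝓘(ℂ, ℂ) Prod.snd x w)) x₀ v z
      = v.2 * chartCoeff 𝓘(ℂ, ℂ) (fun y v => α y v) x₀.2 1 z.2 := by
  rw [← chartCoeff_eq_mul]
  simp only [chartCoeff]
  rw [mfderiv_snd, mfderiv_extChartAt_prod_symm x₀ hz]
  rfl

lemma differentiableOn_chartCoeff_fst {α : ∀ y : Y, TangentSpace 𝓘(ℂ, ℂ) y →ₗ[ℂ] ℂ}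
    (hα : α ∈ holOneForms 𝓘(ℂ, ℂ) Y) (x₀ : Y × Y) (v : ℂ × ℂ) :
    DifferentiableOn ℂ (chartCoeff (𝓘(ℂ, ℂ).prod 𝓘(ℂ, ℂ)) (fun (x : Y × Y) w => α x.1
      (mfderiv (𝓘(ℂ, ℂ).prod 𝓘(ℂ, ℂ)) 𝓘(ℂ, ℂ) Prod.fst x w)) x₀ v)
      (extChartAt (𝓘(ℂ, ℂ).prod 𝓘(ℂ, ℂ)) x₀).target := by
  refine DifferentiableOn.congr ?_ fun z hz => chartCoeff_fst α x₀ v hz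
  have hd := hα x₀.1 1
  simp only [preimage_univ, inter_univ] at hd
  refine (hd.comp differentiableOn_fst fun z hz => ?_).const_mul v.1
  rw [extChartAt_prod] at hz
  exact hz.1

lemma differentiableOn_chartCoeff_snd {α : ∀ y : Y, TangentSpace 𝓘(ℂ, ℂ) y →ₗ[ℂ] ℂ}
    (hα : α ∈ holOneForms 𝓘(ℂ, ℂ) Y) (x₀ : Y × Y) (v : ℂ × ℂ) :
    DifferentiableOn ℂ (chartCoeff (𝓘(ℂ, ℂ).prod 𝓘(ℂ, ℂ)) (fun (x : Y × Y) w => α x.2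
      (mfderiv (𝓘(ℂ, ℂ).prod 𝓘(ℂ, ℂ)) 𝓘(ℂ, ℂ) Prod.snd x w)) x₀ v)
      (extChartAt (𝓘(ℂ, ℂ).prod 𝓘(ℂ, ℂ)) x₀).target := by
  refine DifferentiableOn.congr ?_ fun z hz => chartCoeff_snd α x₀ v hz
  have hd := hα x₀.2 1
  simp only [preimage_univ, inter_univ] at hd
  refine (hd.comp differentiableOn_snd fun z hz => ?_).const_mul v.2
  rw [extChartAt_prod] at hz
  exact hz.2

/-- Holomorphic one-forms on a curve are closed, hence so are their pull-backs. -/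
lemma extDerivForm_fst {α : ∀ y : Y, TangentSpace 𝓘(ℂ, ℂ) y →ₗ[ℂ] ℂ}
    (hα : α ∈ holOneForms 𝓘(ℂ, ℂ) Y) (x : Y × Y)
    (u v : TangentSpace (𝓘(ℂ, ℂ).prod 𝓘(ℂ, ℂ)) x) :
    extDerivForm (𝓘(ℂ, ℂ).prod 𝓘(ℂ, ℂ)) (fun (x : Y × Y) w => α x.1
      (mfderiv (𝓘(ℂ, ℂ).prod 𝓘(ℂ, ℂ)) 𝓘(ℂ, ℂ) Prod.fst x w)) x u v = 0 := by
  have hd := hα x.1 1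
  simp only [preimage_univ, inter_univ] at hd
  exact extDerivForm_eq_zero x (ContinuousLinearMap.fst ℂ ℂ ℂ) _
    (fun a z hz => chartCoeff_fst α x a hz) (hd.differentiableAt
      ((isOpen_extChartAt_target x.1).mem_nhds (mem_extChartAt_target x.1))) u v

lemma extDerivForm_snd {α : ∀ y : Y, TangentSpace 𝓘(ℂ, ℂ) y →ₗ[ℂ] ℂ}
    (hα : α ∈ holOneForms 𝓘(ℂ, ℂ) Y) (x : Y × Y)
    (u v : TangentSpace (𝓘(ℂ, ℂ).prod 𝓘(ℂ, ℂ)) x) :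
    extDerivForm (𝓘(ℂ, ℂ).prod 𝓘(ℂ, ℂ)) (fun (x : Y × Y) w => α x.2
      (mfderiv (𝓘(ℂ, ℂ).prod 𝓘(ℂ, ℂ)) 𝓘(ℂ, ℂ) Prod.snd x w)) x u v = 0 := by
  have hd := hα x.2 1
  simp only [preimage_univ, inter_univ] at hd
  exact extDerivForm_eq_zero x (ContinuousLinearMap.snd ℂ ℂ ℂ) _
    (fun a z hz => chartCoeff_snd α x a hz) (hd.differentiableAt
      ((isOpen_extChartAt_target x.2).mem_nhds (mem_extChartAt_target x.2))) u v

lemma extDerivForm_productForm {α₁ α₂ : ∀ y : Y, TangentSpace 𝓘(ℂ, ℂ) y →ₗ[ℂ] ℂ}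
    (h₁ : α₁ ∈ holOneForms 𝓘(ℂ, ℂ) Y) (h₂ : α₂ ∈ holOneForms 𝓘(ℂ, ℂ) Y) (x : Y × Y)
    (u v : TangentSpace (𝓘(ℂ, ℂ).prod 𝓘(ℂ, ℂ)) x) (a b : Fin 3) :
    extDerivForm (𝓘(ℂ, ℂ).prod 𝓘(ℂ, ℂ)) (fun y w => productForm α₁ α₂ y w a b) x u v = 0 := by
  have h0 : extDerivForm (𝓘(ℂ, ℂ).prod 𝓘(ℂ, ℂ)) (fun (_ : Y × Y) _ => (0 : ℂ)) x u v = 0 :=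
    extDerivForm_eq_zero x 0 0 (fun a z _ => by simp [chartCoeff]) (differentiableAt_const 0) u v
  fin_cases a <;> fin_cases b <;>
    first
    | exact h0
    | exact extDerivForm_fst h₁ x u v
    | exact extDerivForm_snd h₂ x u v

lemma isHolFormOn_productForm {α₁ α₂ : ∀ y : Y, TangentSpace 𝓘(ℂ, ℂ) y →ₗ[ℂ] ℂ}
    (h₁ : α₁ ∈ holOneForms 𝓘(ℂ, ℂ) Y) (h₂ : α₂ ∈ holOneForms 𝓘(ℂ, ℂ) Y) (a b : Fin 3) :
    IsHolFormOn (𝓘(ℂ, ℂ).prod 𝓘(ℂ, ℂ))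
      (fun (y : Y × Y) w => productForm α₁ α₂ y w a b) univ := by
  intro x₀ v
  simp only [preimage_univ, inter_univ]
  fin_cases a <;> fin_cases b <;>
    first
    | exact differentiableOn_const (0 : ℂ)
    | exact differentiableOn_chartCoeff_fst h₁ x₀ v
    | exact differentiableOn_chartCoeff_snd h₂ x₀ v

lemma adG_one {d : ℕ} (a : gAlg d) : adG 1 a = a :=
  Subtype.ext (by simp [adG, conj, lift_one])

lemma adH_one {d : ℕ} (a : hAlg d) : adH 1 a = a :=
  Subtype.ext (by simp [adH, conj, lift_one])

/-- A constant map to `Q` has vanishing logarithmic derivative. -/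
lemma maurerCartan_const {E H : Type*} [NormedAddCommGroup E] [NormedSpace ℂ E]
    [TopologicalSpace H] (I : ModelWithCorners ℂ E H) {X : Type u} [TopologicalSpace X]
    [ChartedSpace H X] {d : ℕ} (q : parabolic d) (x : X) :
    maurerCartan I (fun _ => q) x = 0 := by
  have h : dLift I (fun _ : X => q) x = 0 := by
    refine LinearMap.ext fun v => ?_
    ext a b
    change (mfderiv I 𝓘(ℂ, ℂ) (fun _ : X =>
      (lift q : Matrix (Fin (d + 1)) (Fin (d + 1)) ℂ) a b) x v : ℂ) = 0
    rw [mfderiv_const]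
    rfl
  refine LinearMap.ext fun v => Subtype.ext ?_
  simp [maurerCartan, h]

/-- The branched geometry on `Y × Y` defined by two nonzero holomorphic one-forms on `Y`. -/
def productGeometry {α₁ α₂ : ∀ y : Y, TangentSpace 𝓘(ℂ, ℂ) y →ₗ[ℂ] ℂ}
    (h₁ : α₁ ∈ holOneForms 𝓘(ℂ, ℂ) Y) (h₂ : α₂ ∈ holOneForms 𝓘(ℂ, ℂ) Y)
    (n₁ : α₁ ≠ 0) (n₂ : α₂ ≠ 0) :
    BranchedGeometry (𝓘(ℂ, ℂ).prod 𝓘(ℂ, ℂ))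
      (trivialBundle (𝓘(ℂ, ℂ).prod 𝓘(ℂ, ℂ)) (Y × Y) 2) where
  θ _ x := productTheta α₁ α₂ x
  compatible i j x _ z := by
    have h : atiyahChange (trivialBundle (𝓘(ℂ, ℂ).prod 𝓘(ℂ, ℂ)) (Y × Y) 2) i j x z = z := by
      refine Prod.ext ?_ rfl
      change adH 1 z.1 - maurerCartan _ (fun _ => 1) x z.2 = z.1
      rw [maurerCartan_const, adH_one]
      exact sub_zero _
    rw [h]
    exact (adG_one _).symm
  holomorphic i w a b := by
    intro x₀ v
    have h := (isHolFormOn_productForm h₁ h₂ a b x₀ v).const_add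
      ((w : Matrix (Fin 3) (Fin 3) ℂ) a b)
    refine h.congr fun z _ => ?_
    exact congrFun (congrFun (productTheta_apply α₁ α₂ _ w _) a) b
  restrict i x _ w := by
    refine Subtype.ext ?_
    rw [productTheta_apply]
    have : productForm α₁ α₂ x 0 = 0 := (productFormLinear α₁ α₂ x).map_zero
    rw [this, add_zero]
    rfl
  iso := by
    obtain ⟨y₁, hy₁⟩ := exists_apply_one_ne_zero n₁
    obtain ⟨y₂, hy₂⟩ := exists_apply_one_ne_zero n₂
    exact ⟨_, (isOpen_ne_zero h₁).prod (isOpen_ne_zero h₂), ⟨(y₁, y₂), hy₁, hy₂⟩,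
      fun _ x hx => productTheta_bijective hx.1.1 hx.1.2⟩

/-- The curvature reduces to the commutator, as the entries of the connection form are closed. -/
lemma productGeometry_curvature {α₁ α₂ : ∀ y : Y, TangentSpace 𝓘(ℂ, ℂ) y →ₗ[ℂ] ℂ}
    (h₁ : α₁ ∈ holOneForms 𝓘(ℂ, ℂ) Y) (h₂ : α₂ ∈ holOneForms 𝓘(ℂ, ℂ) Y)
    (n₁ : α₁ ≠ 0) (n₂ : α₂ ≠ 0) (i) (x : Y × Y) (u v : ℂ × ℂ) :
    (productGeometry h₁ h₂ n₁ n₂).curvature i x u v =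
      ((u.1 * v.2 - v.1 * u.2) * (α₁ x.1 (1 : ℂ) * α₂ x.2 (1 : ℂ))) •
        (!![1, 0, 0; 0, 0, 0; 0, 0, -1] : Matrix (Fin 3) (Fin 3) ℂ) := by
  have hc : ∀ y (w : TangentSpace (𝓘(ℂ, ℂ).prod 𝓘(ℂ, ℂ)) y),
      (productGeometry h₁ h₂ n₁ n₂).connForm i y w = productForm α₁ α₂ y w := by
    intro y w
    refine (productTheta_apply α₁ α₂ y 0 w).trans ?_
    simp
  have hd : Matrix.of (fun a b => extDerivForm (𝓘(ℂ, ℂ).prod 𝓘(ℂ, ℂ))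
      (fun y w => (productGeometry h₁ h₂ n₁ n₂).connForm i y w a b) x u v) = 0 := by
    ext a b
    simp only [hc]
    exact extDerivForm_productForm h₁ h₂ x u v a b
  have hA : ∀ w : ℂ × ℂ, (productGeometry h₁ h₂ n₁ n₂).connForm i x w
      = !![0, 0, w.1 * α₁ x.1 (1 : ℂ); w.1 * α₁ x.1 (1 : ℂ), 0, 0;
        w.2 * α₂ x.2 (1 : ℂ), 0, 0] := fun w => (hc x w).trans (productForm_eq α₁ α₂ x w)
  refine (congrArg₂ (· + ·) hd (congrArg₂ (· - ·) (congrArg₂ (· * ·) (hA u) (hA v))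
    (congrArg₂ (· * ·) (hA v) (hA u)))).trans ?_
  ext a b
  fin_cases a <;> fin_cases b <;> simp <;> ring

lemma productGeometry_isNormal {α₁ α₂ : ∀ y : Y, TangentSpace 𝓘(ℂ, ℂ) y →ₗ[ℂ] ℂ}
    (h₁ : α₁ ∈ holOneForms 𝓘(ℂ, ℂ) Y) (h₂ : α₂ ∈ holOneForms 𝓘(ℂ, ℂ) Y)
    (n₁ : α₁ ≠ 0) (n₂ : α₂ ≠ 0) : (productGeometry h₁ h₂ n₁ n₂).IsNormal := by
  intro i x _ u v
  refine (productGeometry_curvature h₁ h₂ n₁ n₂ i x u v).symm ▸ (hAlg 2).smul_mem _ ⟨?_, ?_⟩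
  · simp [Matrix.trace_fin_three]
  · intro i hi
    fin_cases i
    · exact absurd rfl hi
    · rfl
    · rfl

lemma productGeometry_not_isFlat {α₁ α₂ : ∀ y : Y, TangentSpace 𝓘(ℂ, ℂ) y →ₗ[ℂ] ℂ}
    (h₁ : α₁ ∈ holOneForms 𝓘(ℂ, ℂ) Y) (h₂ : α₂ ∈ holOneForms 𝓘(ℂ, ℂ) Y)
    (n₁ : α₁ ≠ 0) (n₂ : α₂ ≠ 0) : ¬ (productGeometry h₁ h₂ n₁ n₂).IsFlat := by
  intro h
  obtain ⟨y₁, hy₁⟩ := exists_apply_one_ne_zero n₁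
  obtain ⟨y₂, hy₂⟩ := exists_apply_one_ne_zero n₂
  have h' := (productGeometry_curvature h₁ h₂ n₁ n₂ PUnit.unit (y₁, y₂) (1, 0) (0, 1)).symm.trans
    (h PUnit.unit (y₁, y₂) (mem_univ _) _ _)
  have h00 := congrFun (congrFun h' 0) 0
  simp [hy₁, hy₂] at h00

end Product

/-! ### The Riemann sphere -/

section Sphere

open Filter Topology

/-- The inversion `z ↦ 1/z` of the Riemann sphere `OnePoint ℂ`. -/
def sphereInv : OnePoint ℂ → OnePoint ℂ
  | .infty => ((0 : ℂ) : OnePoint ℂ)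
  | .some z => if z = 0 then .infty else ((z⁻¹ : ℂ) : OnePoint ℂ)

@[simp] lemma sphereInv_infty : sphereInv .infty = ((0 : ℂ) : OnePoint ℂ) := rfl

@[simp] lemma sphereInv_zero : sphereInv ((0 : ℂ) : OnePoint ℂ) = .infty := if_pos rfl

lemma sphereInv_coe {z : ℂ} (hz : z ≠ 0) :
    sphereInv (z : OnePoint ℂ) = ((z⁻¹ : ℂ) : OnePoint ℂ) := if_neg hz

lemma sphereInv_involutive : Function.Involutive sphereInv := by
  intro x
  induction x using OnePoint.rec with
  | infty => simp
  | coe z =>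
    by_cases hz : z = 0
    · simp [hz]
    · rw [sphereInv_coe hz, sphereInv_coe (inv_ne_zero hz), inv_inv]

lemma sphereInv_coe_eq_coe {a c : ℂ} :
    sphereInv (a : OnePoint ℂ) = (c : OnePoint ℂ) ↔ a * c = 1 := by
  by_cases ha : a = 0
  · simp [ha, OnePoint.infty_ne_coe]
  · rw [sphereInv_coe ha, OnePoint.coe_eq_coe]
    exact ⟨fun h => by rw [← h, mul_inv_cancel₀ ha], fun h => inv_eq_of_mul_eq_one_right h⟩

lemma continuous_sphereInv : Continuous sphereInv := by
  rw [OnePoint.continuous_iff]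
  constructor
  · rw [coclosedCompact_eq_cocompact, ← Metric.cobounded_eq_cocompact]
    have h : Tendsto (fun z : ℂ => ((z⁻¹ : ℂ) : OnePoint ℂ)) (Bornology.cobounded ℂ)
        (𝓝 ((0 : ℂ) : OnePoint ℂ)) :=
      (OnePoint.continuous_coe.tendsto _).comp tendsto_inv₀_cobounded
    refine h.congr' ?_
    filter_upwards [Bornology.eventually_ne_cobounded (0 : ℂ)] with z hz
    exact (sphereInv_coe hz).symm
  · rw [continuous_iff_continuousAt]
    intro z
    by_cases hz : z = 0
    · subst hz
      rw [continuousAt_iff_punctured_nhds]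
      have h : Tendsto (fun z : ℂ => ((z⁻¹ : ℂ) : OnePoint ℂ)) (𝓝[≠] 0) (𝓝 .infty) := by
        refine OnePoint.tendsto_coe_infty.comp ?_
        rw [coclosedCompact_eq_cocompact, ← Metric.cobounded_eq_cocompact]
        exact tendsto_inv₀_nhdsNE_zero
      rw [sphereInv_zero]
      refine h.congr' ?_
      filter_upwards [self_mem_nhdsWithin] with z hz
      exact (sphereInv_coe hz).symm
    · have h : ContinuousAt (fun z : ℂ => ((z⁻¹ : ℂ) : OnePoint ℂ)) z :=
        OnePoint.continuous_coe.continuousAt.comp (continuousAt_inv₀ hz)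
      refine h.congr ?_
      filter_upwards [isOpen_ne.mem_nhds hz] with z hz
      exact (sphereInv_coe hz).symm

/-- The extension to the Riemann sphere of the cube map. -/
def sphereCube : OnePoint ℂ → OnePoint ℂ := OnePoint.map (· ^ 3)

@[simp] lemma sphereCube_infty : sphereCube .infty = .infty := rfl

@[simp] lemma sphereCube_coe (z : ℂ) : sphereCube z = ((z ^ 3 : ℂ) : OnePoint ℂ) := rfl

lemma continuous_sphereCube : Continuous sphereCube := by
  refine OnePoint.continuous_map (continuous_pow 3) ?_
  rw [coclosedCompact_eq_cocompact, ← Metric.cobounded_eq_cocompact,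
    ← tendsto_norm_atTop_iff_cobounded]
  simp only [norm_pow]
  exact (tendsto_pow_atTop (by norm_num)).comp tendsto_norm_cobounded_atTop

lemma sphereCube_sphereInv (x : OnePoint ℂ) :
    sphereCube (sphereInv x) = sphereInv (sphereCube x) := by
  induction x using OnePoint.rec with
  | infty => simp
  | coe z =>
    by_cases hz : z = 0
    · simp [hz]
    · rw [sphereInv_coe hz, sphereCube_coe, sphereCube_coe, sphereInv_coe (pow_ne_zero 3 hz),
        inv_pow]

lemma isOpenMap_cube : IsOpenMap (fun z : ℂ => z ^ 3) := by
  have h : AnalyticOnNhd ℂ (fun z : ℂ => z ^ 3) univ := fun z _ => by fun_prop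
  rcases h.is_constant_or_isOpen isPreconnected_univ with ⟨w, hw⟩ | h
  · have h0 := hw 0 (mem_univ _)
    have h1 := hw 1 (mem_univ _)
    simp only [← h0] at h1
    norm_num at h1
  · exact fun s hs => h s (subset_univ s) hs

/-- Away from `∞` this is the open mapping theorem, and the inversion exchanges `0` and `∞`. -/
lemma isOpenMap_sphereCube : IsOpenMap sphereCube := by
  have key : ∀ s : Set (OnePoint ℂ), IsOpen s → s ⊆ range ((↑) : ℂ → OnePoint ℂ) →
      IsOpen (sphereCube '' s) := by
    intro s hs hr
    have h : sphereCube '' s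
        = ((↑) : ℂ → OnePoint ℂ) '' ((fun z : ℂ => z ^ 3) '' (((↑) : ℂ → OnePoint ℂ) ⁻¹' s)) := by
      conv_lhs => rw [← image_preimage_eq_of_subset hr]
      rw [image_image, image_image]
      rfl
    rw [h, OnePoint.isOpen_image_coe]
    exact isOpenMap_cube _ (hs.preimage OnePoint.continuous_coe)
  intro s hs
  have h1 := key (s ∩ range ((↑) : ℂ → OnePoint ℂ)) (hs.inter OnePoint.isOpen_range_coe)
    inter_subset_right
  have h2 := (key (sphereInv ⁻¹' s ∩ range ((↑) : ℂ → OnePoint ℂ))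
    ((hs.preimage continuous_sphereInv).inter OnePoint.isOpen_range_coe)
    inter_subset_right).preimage continuous_sphereInv
  convert h1.union h2 using 1
  ext w
  constructor
  · rintro ⟨x, hx, rfl⟩
    by_cases hx' : x ∈ range ((↑) : ℂ → OnePoint ℂ)
    · exact Or.inl ⟨x, ⟨hx, hx'⟩, rfl⟩
    · rw [OnePoint.notMem_range_coe_iff] at hx'
      subst hx'
      refine Or.inr ⟨((0 : ℂ) : OnePoint ℂ), ⟨?_, mem_range_self _⟩, ?_⟩
      · simpa using hx
      · simp
  · rintro (⟨x, hx, rfl⟩ | ⟨x, hx, h⟩)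
    · exact ⟨x, hx.1, rfl⟩
    · refine ⟨sphereInv x, hx.1, ?_⟩
      rw [sphereCube_sphereInv, h, sphereInv_involutive]

/-- The map `z ↦ -z` of the Riemann sphere. -/
def sphereNeg : OnePoint ℂ ≃ₜ OnePoint ℂ := (Homeomorph.neg ℂ).onePointCongr

@[simp] lemma sphereNeg_infty : sphereNeg .infty = .infty := rfl

@[simp] lemma sphereNeg_coe (z : ℂ) : sphereNeg z = ((-z : ℂ) : OnePoint ℂ) := rfl

lemma sphereNeg_involutive : Function.Involutive sphereNeg := by
  intro x
  induction x using OnePoint.rec <;> simp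

lemma sphereCube_sphereNeg (x : OnePoint ℂ) :
    sphereCube (sphereNeg x) = sphereNeg (sphereCube x) := by
  induction x using OnePoint.rec with
  | infty => rfl
  | coe z => simp [Odd.neg_pow (by decide : Odd 3)]

/-- The Möbius involution `w ↦ (w + 1)/(w - 1) = 1 + 2/(w - 1)` of the Riemann sphere. -/
def moebius (w : OnePoint ℂ) : OnePoint ℂ :=
  ((Homeomorph.mulLeft₀ (2 : ℂ) two_ne_zero).trans (Homeomorph.addLeft 1)).onePointCongr
    (sphereInv ((Homeomorph.subRight (1 : ℂ)).onePointCongr w))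

lemma continuous_moebius : Continuous moebius :=
  (Homeomorph.continuous _).comp (continuous_sphereInv.comp (Homeomorph.continuous _))

@[simp] lemma moebius_infty : moebius .infty = ((1 : ℂ) : OnePoint ℂ) := by
  change (((1 + 2 * 0 : ℂ)) : OnePoint ℂ) = _
  simp

@[simp] lemma moebius_one : moebius ((1 : ℂ) : OnePoint ℂ) = .infty := by
  change (Homeomorph.onePointCongr _) (sphereInv ((1 - 1 : ℂ) : OnePoint ℂ)) = _
  rw [sub_self, sphereInv_zero]
  rfl

lemma moebius_coe {w : ℂ} (hw : w ≠ 1) :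
    moebius w = (((w + 1) / (w - 1) : ℂ) : OnePoint ℂ) := by
  have h : w - 1 ≠ 0 := sub_ne_zero.2 hw
  change (Homeomorph.onePointCongr _) (sphereInv ((w - 1 : ℂ) : OnePoint ℂ)) = _
  rw [sphereInv_coe h]
  change ((1 + 2 * (w - 1)⁻¹ : ℂ) : OnePoint ℂ) = _
  congr 1
  field_simp
  ring

lemma moebius_coe_eq_coe {w z : ℂ} :
    moebius w = (z : OnePoint ℂ) ↔ z * (w - 1) = w + 1 := by
  by_cases hw : w = 1
  · subst hw
    simp only [moebius_one, OnePoint.infty_ne_coe, sub_self, mul_zero, false_iff]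
    norm_num
  · rw [moebius_coe hw, OnePoint.coe_eq_coe, div_eq_iff (sub_ne_zero.2 hw), eq_comm]

lemma moebius_involutive : Function.Involutive moebius := by
  intro x
  induction x using OnePoint.rec with
  | infty => simp
  | coe w =>
    by_cases hw : w = 1
    · simp [hw]
    · rw [moebius_coe hw, moebius_coe_eq_coe]
      have h : w - 1 ≠ 0 := sub_ne_zero.2 hw
      field_simp
      ring

lemma moebius_sphereInv (x : OnePoint ℂ) : moebius (sphereInv x) = sphereNeg (moebius x) := by
  induction x using OnePoint.rec with
  | infty =>
    rw [sphereInv_infty, moebius_coe zero_ne_one]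
    simp
  | coe w =>
    by_cases h0 : w = 0
    · subst h0
      rw [sphereInv_zero, moebius_coe zero_ne_one]
      simp
    by_cases hw : w = 1
    · subst hw
      rw [sphereInv_coe one_ne_zero, inv_one]
      simp
    · rw [sphereInv_coe h0, moebius_coe hw, sphereNeg_coe, moebius_coe_eq_coe]
      have h : w - 1 ≠ 0 := sub_ne_zero.2 hw
      field_simp
      ring

end Sphere

/-! ### A curve of bidegree three, three -/

section Curve

/-- The compactification in `ℂP¹ × ℂP¹` of the affine curve `y³ (x³ - 1) = x³ + 1`: the pairs with
`M(x³) = y³` for the Möbius involution `M(w) = (w + 1)/(w - 1)`. -/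
def Curve : Type := {p : OnePoint ℂ × OnePoint ℂ // moebius (sphereCube p.1) = sphereCube p.2}

instance : TopologicalSpace Curve := instTopologicalSpaceSubtype

instance : T2Space Curve :=
  inferInstanceAs (T2Space {p : OnePoint ℂ × OnePoint ℂ //
    moebius (sphereCube p.1) = sphereCube p.2})

instance : CompactSpace Curve :=
  isCompact_iff_compactSpace.1 (IsClosed.isCompact (isClosed_eq
    ((continuous_moebius.comp continuous_sphereCube).comp continuous_fst)
    (continuous_sphereCube.comp continuous_snd)))

lemma coe_mem_curve_iff {a b : ℂ} :
    moebius (sphereCube (a : OnePoint ℂ)) = sphereCube (b : OnePoint ℂ) ↔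
      b ^ 3 * (a ^ 3 - 1) = a ^ 3 + 1 := by
  rw [sphereCube_coe, sphereCube_coe, moebius_coe_eq_coe]

instance : Inhabited Curve :=
  ⟨⟨(((-1 : ℂ) : OnePoint ℂ), ((0 : ℂ) : OnePoint ℂ)), by rw [coe_mem_curve_iff]; norm_num⟩⟩

lemma continuous_curve_val : Continuous (fun p : Curve => p.1) := continuous_subtype_val

/-- The projection is the base change of the open map `sphereCube` along `x ↦ M(x³)`. -/
lemma isOpenMap_curve_fst : IsOpenMap (fun p : Curve => p.1.1) := by
  rw [isOpenMap_iff_nhds_le]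
  intro p s hs
  rw [Filter.mem_map] at hs
  obtain ⟨t, ht, hts⟩ := (mem_nhds_subtype _ p _).1 hs
  obtain ⟨u, hu, v, hv, huv⟩ := mem_nhds_prod_iff.1 ht
  have h1 : (moebius ∘ sphereCube) ⁻¹' (sphereCube '' v) ∈ nhds p.1.1 := by
    refine (continuous_moebius.comp continuous_sphereCube).continuousAt ?_
    rw [Function.comp_apply, p.2]
    exact isOpenMap_sphereCube.image_mem_nhds hv
  filter_upwards [hu, h1] with x hx hx'
  obtain ⟨y, hy, hxy⟩ := hx'
  exact hts (show (⟨(x, y), hxy.symm⟩ : Curve).1 ∈ t from huv ⟨hx, hy⟩)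

/-- The first projection is open and closed, so each nonempty clopen set meets every fibre; the
fibre over the branch point `-1` has one element. -/
instance : ConnectedSpace Curve := by
  have hsurj : ∀ s : Set Curve, IsClopen s → s.Nonempty →
      (fun p : Curve => p.1.1) '' s = univ := by
    intro s hs hne
    refine IsClopen.eq_univ ⟨?_, isOpenMap_curve_fst s hs.2⟩ (hne.image _)
    exact (hs.1.isCompact.image (continuous_fst.comp continuous_curve_val)).isClosed
  have hfib : ∀ p : Curve, p.1.1 = ((-1 : ℂ) : OnePoint ℂ) → p = default := by
    rintro ⟨⟨x, y⟩, h⟩ (rfl : x = _)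
    refine Subtype.ext (Prod.ext rfl ?_)
    induction y using OnePoint.rec with
    | infty =>
      exfalso
      have h' : moebius ((-1 : ℂ) ^ 3 : ℂ) = .infty := h
      rw [moebius_coe (by norm_num)] at h'
      exact OnePoint.coe_ne_infty _ h'
    | coe b =>
      have h' := coe_mem_curve_iff.1 h
      have hb : b = 0 := by
        norm_num at h'
        exact h'
      exact congrArg (fun z : ℂ => (z : OnePoint ℂ)) hb
  have hdef : ∀ s : Set Curve, IsClopen s → s.Nonempty → default ∈ s := by
    intro s hs hne
    obtain ⟨p, hp, hp'⟩ := (hsurj s hs hne).symm ▸ mem_univ ((-1 : ℂ) : OnePoint ℂ)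
    exact hfib p hp' ▸ hp
  have : PreconnectedSpace Curve := by
    rw [preconnectedSpace_iff_clopen]
    intro s hs
    by_contra! hc
    exact hdef sᶜ hs.compl (nonempty_compl.2 hc.2) (hdef s hs hc.1)
  exact ⟨inferInstance⟩

/-- The automorphism `(x, y) ↦ (1/x, -y)` of the curve. -/
def curveInv : Curve ≃ₜ Curve := by
  let f : Curve → Curve := fun p => ⟨(sphereInv p.1.1, sphereNeg p.1.2), by
    rw [sphereCube_sphereInv, moebius_sphereInv, p.2, sphereCube_sphereNeg]⟩
  have hf : Function.Involutive f := fun p =>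
    Subtype.ext (Prod.ext (sphereInv_involutive _) (sphereNeg_involutive _))
  have hc : Continuous f := Continuous.subtype_mk
    ((continuous_sphereInv.comp (continuous_fst.comp continuous_curve_val)).prodMk
      (sphereNeg.continuous.comp (continuous_snd.comp continuous_curve_val))) _
  exact { hf.toPerm f with continuous_toFun := hc, continuous_invFun := hc }

/-- The automorphism `(x, y) ↦ (y, x)` of the curve. -/
def curveSwap : Curve ≃ₜ Curve := by
  let f : Curve → Curve := fun p => ⟨(p.1.2, p.1.1), by
    rw [← p.2, moebius_involutive]⟩
  have hf : Function.Involutive f := fun p => Subtype.ext rfl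
  have hc : Continuous f := Continuous.subtype_mk
    ((continuous_snd.comp continuous_curve_val).prodMk
      (continuous_fst.comp continuous_curve_val)) _
  exact { hf.toPerm f with continuous_toFun := hc, continuous_invFun := hc }

/-- The four automorphisms that move any point of the curve to the part of the affine curve where
`y ≠ 0`, where `x` is a local coordinate. The second index says whether the coordinates are
swapped, the first whether `(x, y) ↦ (1/x, -y)` is applied afterwards. -/
def curveSymm : Bool × Bool → Curve ≃ₜ Curve
  | (false, false) => Homeomorph.refl Curve
  | (true, false) => curveInv
  | (false, true) => curveSwap
  | (true, true) => curveSwap.trans curveInv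

/-- If `y` is `0` or `∞`, then `x³ = -1` or `x³ = 1`, so that `x` is neither `0` nor `∞`. -/
lemma exists_curveSymm_eq_coe (p : Curve) :
    ∃ s, ∃ a b : ℂ, b ≠ 0 ∧ (curveSymm s p).1 = ((a : OnePoint ℂ), (b : OnePoint ℂ)) := by
  have key : ∀ p : Curve, (p.1.2 = ((0 : ℂ) : OnePoint ℂ) ∨ p.1.2 = .infty) →
      ∃ a : ℂ, a ≠ 0 ∧ p.1.1 = (a : OnePoint ℂ) := by
    rintro ⟨⟨x, y⟩, h⟩ hy
    induction x using OnePoint.rec with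
    | infty =>
      exfalso
      rcases hy with (rfl : y = _) | (rfl : y = _)
      · have h' : ((1 : ℂ) : OnePoint ℂ) = ((0 ^ 3 : ℂ) : OnePoint ℂ) := moebius_infty.symm.trans h
        rw [OnePoint.coe_eq_coe] at h'
        norm_num at h'
      · exact OnePoint.coe_ne_infty _ (moebius_infty.symm.trans h)
    | coe a =>
      refine ⟨a, ?_, rfl⟩
      rintro rfl
      rcases hy with (rfl : y = _) | (rfl : y = _)
      · have h' := coe_mem_curve_iff.1 h
        norm_num at h'
      · have h' : moebius ((0 : ℂ) ^ 3 : ℂ) = .infty := h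
        rw [moebius_coe (by norm_num)] at h'
        exact OnePoint.coe_ne_infty _ h'
  obtain ⟨⟨x, y⟩, h⟩ := p
  by_cases hy : y = ((0 : ℂ) : OnePoint ℂ)
  · obtain ⟨a, ha, hx⟩ := key ⟨(x, y), h⟩ (Or.inl hy)
    obtain rfl : x = a := hx
    exact ⟨(false, true), 0, a, ha, Prod.ext hy rfl⟩
  by_cases hy' : y = .infty
  · obtain ⟨a, ha, hx⟩ := key ⟨(x, y), h⟩ (Or.inr hy')
    obtain rfl : x = a := hx
    refine ⟨(true, true), 0, -a, neg_ne_zero.2 ha, Prod.ext ?_ rfl⟩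
    change sphereInv y = _
    rw [hy', sphereInv_infty]
  obtain ⟨b, rfl⟩ := OnePoint.ne_infty_iff_exists.1 hy'
  have hb : b ≠ 0 := fun h => hy (by rw [h])
  by_cases hx : x = .infty
  · refine ⟨(true, false), 0, -b, neg_ne_zero.2 hb, Prod.ext ?_ rfl⟩
    change sphereInv x = _
    rw [hx, sphereInv_infty]
  · obtain ⟨a, rfl⟩ := OnePoint.ne_infty_iff_exists.1 hx
    exact ⟨(false, false), a, b, hb, rfl⟩

end Curve

/-! ### Complex structure and holomorphic forms on the curve -/

section Charts

/-- The affine coordinate on the Riemann sphere, with the junk value `0` at `∞`. -/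
def affineCoord (x : OnePoint ℂ) : ℂ := x.elim 0 id

@[simp] lemma affineCoord_coe (z : ℂ) : affineCoord (z : OnePoint ℂ) = z := rfl

lemma continuousAt_affineCoord (z : ℂ) : ContinuousAt affineCoord (z : OnePoint ℂ) :=
  OnePoint.continuousAt_coe.2 continuousAt_id

/-- A chart of the curve of type `s`: its coordinate is the first coordinate after the automorphism
`curveSymm s`, it is defined at points where the second coordinate is not `0` or `∞`, and that
second coordinate is a holomorphic function of the first. -/
structure IsCurveChart (s : Bool × Bool) (φ : OpenPartialHomeomorph Curve ℂ) : Prop where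
  fst_eq : ∀ p ∈ φ.source, (curveSymm s p).1.1 = ((φ p : ℂ) : OnePoint ℂ)
  snd_eq : ∀ p ∈ φ.source, ∃ b : ℂ, b ≠ 0 ∧ (curveSymm s p).1.2 = (b : OnePoint ℂ)
  differentiableOn_snd : DifferentiableOn ℂ
    (fun z => affineCoord (curveSymm s (φ.symm z)).1.2) φ.target

lemma cube_sub_one_ne_zero {a b : ℂ} (h : b ^ 3 * (a ^ 3 - 1) = a ^ 3 + 1) : a ^ 3 - 1 ≠ 0 := by
  intro h1
  rw [h1, sub_eq_zero.1 h1] at h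
  norm_num at h

lemma exists_cube_localInverse {b : ℂ} (hb : b ≠ 0) :
    ∃ e : OpenPartialHomeomorph ℂ ℂ, b ∈ e.source ∧ 0 ∉ e.source ∧ ∀ z, e z = z ^ 3 := by
  have h : HasStrictFDerivAt (fun z : ℂ => z ^ 3)
      ((ContinuousLinearEquiv.unitsEquivAut ℂ (Units.mk0 (3 * b ^ 2) (by simp [hb])) :
        ℂ ≃L[ℂ] ℂ) : ℂ →L[ℂ] ℂ) b :=
    HasStrictDerivAt.hasStrictFDerivAt_equiv (by simpa using hasStrictDerivAt_pow 3 b) _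
  refine ⟨(h.toOpenPartialHomeomorph _).restrOpen {0}ᶜ isOpen_compl_singleton, ?_, ?_, ?_⟩
  · exact ⟨h.mem_toOpenPartialHomeomorph_source, hb⟩
  · exact fun h => h.2 rfl
  · exact fun z => rfl

/-- The chart at a point of the affine curve with `y ≠ 0`: the coordinate `x`, with inverse
`x ↦ (x, y)` for a local branch `y` of the cube root of `(x³ + 1)/(x³ - 1)`. -/
lemma exists_affine_chart (a : ℂ) {b : ℂ} (hb : b ≠ 0) :
    ∃ φ : OpenPartialHomeomorph Curve ℂ, IsCurveChart (false, false) φ ∧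
      ∀ p : Curve, p.1 = ((a : OnePoint ℂ), (b : OnePoint ℂ)) → p ∈ φ.source := by
  classical
  obtain ⟨e, hbe, h0e, he⟩ := exists_cube_localInverse hb
  let f : ℂ → ℂ := fun z => (z ^ 3 + 1) / (z ^ 3 - 1)
  have hfb : ∀ {a b : ℂ}, b ^ 3 * (a ^ 3 - 1) = a ^ 3 + 1 → f a = b ^ 3 := fun h =>
    (div_eq_iff (cube_sub_one_ne_zero h)).2 h.symm
  have hf : DifferentiableOn ℂ f {z | z ^ 3 - 1 ≠ 0} := fun z hz =>
    DifferentiableAt.differentiableWithinAt (by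
      have : z ^ 3 - 1 ≠ 0 := hz
      fun_prop (disch := assumption))
  have hopen : IsOpen {z : ℂ | z ^ 3 - 1 ≠ 0} :=
    isOpen_ne.preimage (by fun_prop : Continuous fun z : ℂ => z ^ 3 - 1)
  let T : Set ℂ := {z | z ^ 3 - 1 ≠ 0} ∩ f ⁻¹' e.target
  have hT : IsOpen T := hf.continuousOn.isOpen_inter_preimage hopen e.open_target
  have hesymm : DifferentiableOn ℂ e.symm e.target := by
    intro w hw
    have h1 : e.symm w ≠ 0 := fun h1 => h0e (h1 ▸ e.map_target hw)
    have h2 : HasDerivAt e (3 * (e.symm w) ^ 2) (e.symm w) := by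
      have : (e : ℂ → ℂ) = fun z => z ^ 3 := funext he
      rw [this]
      simpa using hasDerivAt_pow 3 (e.symm w)
    exact (e.hasDerivAt_symm hw (by simp [h1]) h2).differentiableAt.differentiableWithinAt
  have hY : DifferentiableOn ℂ (fun z => e.symm (f z)) T :=
    hesymm.comp (hf.mono inter_subset_left) fun z hz => hz.2
  have hrel : ∀ z ∈ T, moebius (sphereCube (z : OnePoint ℂ))
      = sphereCube ((e.symm (f z) : ℂ) : OnePoint ℂ) := by
    intro z hz
    rw [coe_mem_curve_iff, ← he, e.right_inv hz.2]
    exact div_mul_cancel₀ _ hz.1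
  let inv : ℂ → Curve := fun z =>
    if hz : z ∈ T then ⟨((z : OnePoint ℂ), ((e.symm (f z) : ℂ) : OnePoint ℂ)), hrel z hz⟩
    else default
  have hinv : ∀ z ∈ T, (inv z).1 = ((z : OnePoint ℂ), ((e.symm (f z) : ℂ) : OnePoint ℂ)) := by
    intro z hz
    exact congrArg Subtype.val (dif_pos hz)
  let S : Set Curve := {p | p.1.1 ∈ range ((↑) : ℂ → OnePoint ℂ) ∧
    p.1.2 ∈ ((↑) : ℂ → OnePoint ℂ) '' e.source}
  let φ : OpenPartialHomeomorph Curve ℂ :=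
    { toFun := fun p => affineCoord p.1.1
      invFun := inv
      source := S
      target := T
      map_source' := by
        rintro ⟨⟨x, y⟩, hp⟩ ⟨⟨z, rfl : _ = x⟩, w, hw, rfl : _ = y⟩
        have h1 := coe_mem_curve_iff.1 hp
        refine ⟨cube_sub_one_ne_zero h1, ?_⟩
        change f z ∈ e.target
        rw [hfb h1, ← he]
        exact e.map_source hw
      map_target' := by
        intro z hz
        refine ⟨?_, ?_⟩
        · rw [hinv z hz]; exact mem_range_self z
        · rw [hinv z hz]; exact ⟨_, e.map_target hz.2, rfl⟩
      left_inv' := by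
        rintro ⟨⟨x, y⟩, hp⟩ ⟨⟨z, rfl : _ = x⟩, w, hw, rfl : _ = y⟩
        have h1 := coe_mem_curve_iff.1 hp
        have h2 : e.symm (f z) = w := by rw [hfb h1, ← he, e.left_inv hw]
        have hz : z ∈ T := by
          refine ⟨cube_sub_one_ne_zero h1, ?_⟩
          change f z ∈ e.target
          rw [hfb h1, ← he]
          exact e.map_source hw
        refine Subtype.ext ((hinv z hz).trans ?_)
        rw [h2]
      right_inv' := by
        intro z hz
        rw [hinv z hz]
        rfl
      continuousOn_toFun := by
        intro p hp
        obtain ⟨z, hz⟩ := hp.1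
        refine ContinuousAt.continuousWithinAt ?_
        refine ContinuousAt.comp (g := affineCoord) (f := fun p : Curve => p.1.1) ?_
          (continuous_fst.comp continuous_curve_val).continuousAt
        rw [← hz]
        exact continuousAt_affineCoord z
      continuousOn_invFun := by
        refine Topology.IsInducing.subtypeVal.continuousOn_iff.2 ?_
        refine ContinuousOn.congr ?_ hinv
        exact OnePoint.continuous_coe.continuousOn.prodMk
          (OnePoint.continuous_coe.comp_continuousOn hY.continuousOn)
      open_source := (OnePoint.isOpen_range_coe.preimage
        (continuous_fst.comp continuous_curve_val)).inter
        ((OnePoint.isOpen_image_coe.2 e.open_source).preimage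
          (continuous_snd.comp continuous_curve_val))
      open_target := hT }
  refine ⟨φ, ⟨?_, ?_, ?_⟩, ?_⟩
  · rintro p ⟨⟨z, hz⟩, _⟩
    change p.1.1 = ((affineCoord p.1.1 : ℂ) : OnePoint ℂ)
    rw [← hz]
    rfl
  · rintro p ⟨_, w, hw, hw'⟩
    exact ⟨w, fun h => h0e (h ▸ hw), hw'.symm⟩
  · refine hY.congr fun z hz => ?_
    change affineCoord (inv z).1.2 = _
    rw [hinv z hz]
    rfl
  · intro p hp
    refine ⟨?_, ?_⟩
    · rw [hp]; exact mem_range_self a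
    · rw [hp]; exact ⟨b, hbe, rfl⟩

lemma exists_curveChart (p : Curve) :
    ∃ φ : OpenPartialHomeomorph Curve ℂ, p ∈ φ.source ∧ ∃ s, IsCurveChart s φ := by
  obtain ⟨s, a, b, hb, h⟩ := exists_curveSymm_eq_coe p
  obtain ⟨φ, hφ, hmem⟩ := exists_affine_chart a hb
  refine ⟨(curveSymm s).transOpenPartialHomeomorph φ, hmem _ h, s, ?_, ?_, ?_⟩
  · exact fun q hq => hφ.fst_eq (curveSymm s q) hq
  · exact fun q hq => hφ.snd_eq (curveSymm s q) hq
  · refine hφ.differentiableOn_snd.congr fun z hz => ?_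
    change affineCoord (curveSymm s ((curveSymm s).symm (φ.symm z))).1.2 = _
    rw [Homeomorph.apply_symm_apply]
    rfl

/-- The complex structure of the curve. -/
instance : ChartedSpace ℂ Curve where
  atlas := {φ | ∃ s, IsCurveChart s φ}
  chartAt p := (exists_curveChart p).choose
  mem_chart_source p := (exists_curveChart p).choose_spec.1
  chart_mem_atlas p := (exists_curveChart p).choose_spec.2

/-- The possible relations between the coordinates `(a, b)` and `(c, d)` of one point in charts of
two types. -/
inductive CoordChange
  | refl | inv | swap | swapInv | invSwap | invSwapInv

/-- The relation between coordinates defined by a coordinate change. -/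
def CoordChange.Rel (a b c d : ℂ) : CoordChange → Prop
  | refl => c = a ∧ d = b
  | inv => a * c = 1 ∧ d = -b
  | swap => c = b ∧ d = a
  | swapInv => b * c = 1 ∧ d = -a
  | invSwap => c = -b ∧ a * d = 1
  | invSwapInv => b * c = -1 ∧ a * d = -1

/-- The quotient by `da/(b² (a³ - 1))` of its analogue `dc/(d² (c³ - 1))` in other coordinates. -/
def CoordChange.factor (a b : ℂ) : CoordChange → ℂ
  | refl => 1
  | inv => a
  | swap => -1
  | swapInv => -b
  | invSwap => -a
  | invSwapInv => a * b

/-- The forms `dx/(y² (x³ - 1))` and `x dx/(y² (x³ - 1))` are the products of `da/(b² (a³ - 1))`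
with these factors, `(a, b)` being the coordinates of type `s`. The index is `false` for the first
form and `true` for the second; it always has this meaning below. -/
def formFactor : Bool → Bool × Bool → ℂ → ℂ → ℂ
  | false, (false, false), _, _ => 1
  | false, (true, false), a, _ => a
  | false, (false, true), _, _ => -1
  | false, (true, true), a, _ => -a
  | true, (false, false), a, _ => a
  | true, (true, false), _, _ => 1
  | true, (false, true), _, b => -b
  | true, (true, true), a, b => a * b

lemma sphereNeg_eq_coe {y : OnePoint ℂ} {b : ℂ} :
    sphereNeg y = (b : OnePoint ℂ) ↔ y = ((-b : ℂ) : OnePoint ℂ) := by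
  rw [← sphereNeg_coe, ← sphereNeg_involutive.eq_iff, eq_comm]

lemma sphereInv_eq_coe {x : OnePoint ℂ} {a : ℂ} :
    sphereInv x = (a : OnePoint ℂ) ↔ x = sphereInv (a : OnePoint ℂ) := by
  rw [← sphereInv_involutive.eq_iff, eq_comm]

/-- The coordinate change between charts of two types. -/
def coordChange : Bool × Bool → Bool × Bool → CoordChange
  | (false, false), (false, false) => .refl
  | (true, false), (true, false) => .refl
  | (false, true), (false, true) => .refl
  | (true, true), (true, true) => .refl
  | (false, false), (true, false) => .inv
  | (true, false), (false, false) => .inv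
  | (false, true), (true, true) => .inv
  | (true, true), (false, true) => .inv
  | (false, false), (false, true) => .swap
  | (false, true), (false, false) => .swap
  | (false, false), (true, true) => .swapInv
  | (false, true), (true, false) => .swapInv
  | (true, false), (false, true) => .invSwap
  | (true, true), (false, false) => .invSwap
  | (true, false), (true, true) => .invSwapInv
  | (true, true), (true, false) => .invSwapInv

lemma coordChange_rel (s t : Bool × Bool) {p : Curve} {a b c d : ℂ}
    (hs : (curveSymm s p).1 = ((a : OnePoint ℂ), (b : OnePoint ℂ)))
    (ht : (curveSymm t p).1 = ((c : OnePoint ℂ), (d : OnePoint ℂ))) :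
    (coordChange s t).Rel a b c d := by
  obtain ⟨⟨x, y⟩, hp⟩ := p
  have h00 : (curveSymm (false, false) ⟨(x, y), hp⟩).1 = (x, y) := rfl
  have h10 : (curveSymm (true, false) ⟨(x, y), hp⟩).1 = (sphereInv x, sphereNeg y) := rfl
  have h01 : (curveSymm (false, true) ⟨(x, y), hp⟩).1 = (y, x) := rfl
  have h11 : (curveSymm (true, true) ⟨(x, y), hp⟩).1 = (sphereInv y, sphereNeg x) := rfl
  rcases s with ⟨_ | _, _ | _⟩ <;> rcases t with ⟨_ | _, _ | _⟩ <;>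
    simp only [h00, h10, h01, h11, Prod.mk.injEq, sphereInv_eq_coe, sphereNeg_eq_coe] at hs ht <;>
    obtain ⟨rfl, rfl⟩ := hs <;>
    simp only [sphereInv_involutive.injective.eq_iff, sphereInv_coe_eq_coe, OnePoint.coe_eq_coe,
      eq_comm (b := sphereInv _)] at ht <;>
    simp only [coordChange, CoordChange.Rel] <;> grind

/-- The factors of the two forms are compatible with those of `da/(b² (a³ - 1))`. -/
lemma coordChange_factor (s t : Bool × Bool) {a b c d : ℂ} (h : (coordChange s t).Rel a b c d)
    (i : Bool) :
    (coordChange s t).factor a b * formFactor i t c d = formFactor i s a b := by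
  rcases s with ⟨_ | _, _ | _⟩ <;> rcases t with ⟨_ | _, _ | _⟩ <;> cases i <;>
    simp only [coordChange, CoordChange.Rel, CoordChange.factor, formFactor] at h ⊢ <;> grind

/-- The coefficient of the form `da/(b² (a³ - 1))`. -/
def baseCoeff (a b : ℂ) : ℂ := (b ^ 2 * (a ^ 3 - 1))⁻¹

/-- The form `da/(b² (a³ - 1))` under `(a, b) ↦ (1/a, -b)`. Here `p` and `q` are the derivatives
of `a` and `c = 1/a` with respect to some parameter. -/
lemma inv_baseCoeff {a b c d p q : ℂ} (h : b ^ 3 * (a ^ 3 - 1) = a ^ 3 + 1) (hb : b ≠ 0)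
    (hc : a * c = 1) (hd : d = -b) (hq : a ^ 2 * q = -p) :
    q * baseCoeff c d = p * a * baseCoeff a b := by
  have ha : a ≠ 0 := left_ne_zero_of_mul_eq_one hc
  have h1 := cube_sub_one_ne_zero h
  have h2 : 1 - a ^ 3 ≠ 0 := by rw [← neg_sub]; exact neg_ne_zero.2 h1
  obtain rfl : c = a⁻¹ := (eq_inv_of_mul_eq_one_right hc)
  obtain rfl : q = -p / a ^ 2 := by rw [eq_div_iff (pow_ne_zero 2 ha), ← hq]; ring
  subst hd
  have h3 : (a⁻¹ ^ 3 - 1) = (1 - a ^ 3) / a ^ 3 := by field_simp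
  rw [baseCoeff, baseCoeff, h3]
  field_simp
  ring

/-- The form `da/(b² (a³ - 1))` under `(a, b) ↦ (b, a)`, `Y` being the derivative of `b` with
respect to `a` along the curve. -/
lemma swap_baseCoeff {a b Y : ℂ} (h : b ^ 3 * (a ^ 3 - 1) = a ^ 3 + 1) (ha : a ≠ 0) (hb : b ≠ 0)
    (hY : Y * (b ^ 2 * (a ^ 3 - 1)) = -a ^ 2 * (b ^ 3 - 1)) :
    Y * baseCoeff b a = -baseCoeff a b := by
  have h1 := cube_sub_one_ne_zero h
  have h2 : b ^ 3 - 1 ≠ 0 :=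
    cube_sub_one_ne_zero (a := b) (b := a) (by linear_combination h)
  obtain rfl : Y = -a ^ 2 * (b ^ 3 - 1) / (b ^ 2 * (a ^ 3 - 1)) :=
    (eq_div_iff (mul_ne_zero (pow_ne_zero 2 hb) h1)).2 hY
  rw [baseCoeff, baseCoeff]
  field_simp

/-- The form `da/(b² (a³ - 1))` under `(a, b) ↦ (-b, 1/a)`. -/
lemma invSwap_baseCoeff {a b c d Y : ℂ} (h : b ^ 3 * (a ^ 3 - 1) = a ^ 3 + 1) (hb : b ≠ 0)
    (hY : Y * (b ^ 2 * (a ^ 3 - 1)) = -a ^ 2 * (b ^ 3 - 1)) (hc : c = -b) (hd : a * d = 1) :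
    -Y * baseCoeff c d = -a * baseCoeff a b := by
  have ha : a ≠ 0 := left_ne_zero_of_mul_eq_one hd
  have h1 := cube_sub_one_ne_zero h
  have h2 : b ^ 3 - 1 ≠ 0 :=
    cube_sub_one_ne_zero (a := b) (b := a) (by linear_combination h)
  -- On the curve, `b³ + 1 = a³ (b³ - 1)`.
  have h3 : (-b) ^ 3 - 1 = -(a ^ 3 * (b ^ 3 - 1)) := by linear_combination h
  obtain rfl : Y = -a ^ 2 * (b ^ 3 - 1) / (b ^ 2 * (a ^ 3 - 1)) :=
    (eq_div_iff (mul_ne_zero (pow_ne_zero 2 hb) h1)).2 hY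
  obtain rfl : d = a⁻¹ := (eq_inv_of_mul_eq_one_right hd)
  subst hc
  rw [baseCoeff, baseCoeff, h3]
  field_simp

open Filter Topology in
/-- Under a coordinate change the form `da/(b² (a³ - 1))` is multiplied by `CoordChange.factor`. The
hypotheses say that `(w, b w)` and `(c w, d w)` are coordinates of the same points of the curve. -/
lemma CoordChange.exists_hasDerivAt (κ : CoordChange) {b c d : ℂ → ℂ} {z Y : ℂ}
    (hrel : ∀ᶠ w in 𝓝 z, κ.Rel w (b w) (c w) (d w)) (hb : HasDerivAt b Y z) (hb0 : b z ≠ 0)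
    (hd0 : d z ≠ 0) (h : b z ^ 3 * (z ^ 3 - 1) = z ^ 3 + 1)
    (hY : Y * (b z ^ 2 * (z ^ 3 - 1)) = -z ^ 2 * (b z ^ 3 - 1)) :
    ∃ c', HasDerivAt c c' z ∧
      c' * baseCoeff (c z) (d z) = κ.factor z (b z) * baseCoeff z (b z) := by
  have hz := hrel.self_of_nhds
  have h' : z ^ 3 * (b z ^ 3 - 1) = b z ^ 3 + 1 := by linear_combination h
  cases κ with
  | refl =>
    have he : c =ᶠ[𝓝 z] id := hrel.mono fun w hw => hw.1
    refine ⟨1, (hasDerivAt_id z).congr_of_eventuallyEq he, ?_⟩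
    rw [hz.1, hz.2]
    rfl
  | inv =>
    have he : c =ᶠ[𝓝 z] fun w => w⁻¹ := hrel.mono fun w hw => eq_inv_of_mul_eq_one_right hw.1
    have hz0 : z ≠ 0 := left_ne_zero_of_mul_eq_one hz.1
    refine ⟨_, (hasDerivAt_inv hz0).congr_of_eventuallyEq he, ?_⟩
    rw [inv_baseCoeff (p := 1) h hb0 hz.1 hz.2 (by field_simp), one_mul]
    rfl
  | swap =>
    have he : c =ᶠ[𝓝 z] b := hrel.mono fun w hw => hw.1
    refine ⟨Y, hb.congr_of_eventuallyEq he, ?_⟩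
    have hz0 : z ≠ 0 := hz.2 ▸ hd0
    rw [hz.1, hz.2, swap_baseCoeff h hz0 hb0 hY]
    simp [CoordChange.factor]
  | swapInv =>
    have he : c =ᶠ[𝓝 z] fun w => (b w)⁻¹ :=
      hrel.mono fun w hw => eq_inv_of_mul_eq_one_right hw.1
    have hz0 : z ≠ 0 := fun h0 => hd0 (by rw [hz.2, h0, neg_zero])
    refine ⟨_, (hb.fun_inv hb0).congr_of_eventuallyEq he, ?_⟩
    rw [inv_baseCoeff (p := Y) h' hz0 hz.1 hz.2 (by field_simp), mul_right_comm,
      swap_baseCoeff h hz0 hb0 hY]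
    simp only [CoordChange.factor]
    ring
  | invSwap =>
    have he : c =ᶠ[𝓝 z] fun w => -b w := hrel.mono fun w hw => hw.1
    exact ⟨_, hb.fun_neg.congr_of_eventuallyEq he, invSwap_baseCoeff h hb0 hY hz.1 hz.2⟩
  | invSwapInv =>
    -- This is the change `invSwap` to `(-b, -d)`, followed by `inv`.
    have he : c =ᶠ[𝓝 z] fun w => (-b w)⁻¹ :=
      hrel.mono fun w hw => eq_inv_of_mul_eq_one_right (by linear_combination -hw.1)
    have hzd : z * -d z = 1 := by linear_combination -hz.2
    have hcurve : (-d z) ^ 3 * ((-b z) ^ 3 - 1) = (-b z) ^ 3 + 1 := by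
      have hz0 : z ^ 3 ≠ 0 := pow_ne_zero 3 (left_ne_zero_of_mul_eq_one hzd)
      have h3 : z ^ 3 * (-d z) ^ 3 = 1 := by rw [← mul_pow, hzd, one_pow]
      apply mul_left_cancel₀ hz0
      linear_combination ((-b z) ^ 3 - 1) * h3 + h'
    have hbn : -b z ≠ 0 := neg_ne_zero.2 hb0
    refine ⟨_, (hb.fun_neg.fun_inv hbn).congr_of_eventuallyEq he, ?_⟩
    rw [inv_baseCoeff (a := -b z) (b := -d z) (p := -Y) hcurve (neg_ne_zero.2 hd0)
      (by linear_combination -hz.1) (neg_neg _).symm (by field_simp), mul_right_comm,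
      invSwap_baseCoeff h hb0 hY rfl hzd]
    simp only [CoordChange.factor]
    ring

/-- The coefficient at `p`, with respect to the coordinate of type `s`, of the form
`dx/(y² (x³ - 1))` or `x dx/(y² (x³ - 1))`. -/
def formCoeff (i : Bool) (s : Bool × Bool) (p : Curve) : ℂ :=
  formFactor i s (affineCoord (curveSymm s p).1.1) (affineCoord (curveSymm s p).1.2) *
    baseCoeff (affineCoord (curveSymm s p).1.1) (affineCoord (curveSymm s p).1.2)

namespace IsCurveChart

variable {s t : Bool × Bool} {φ ψ : OpenPartialHomeomorph Curve ℂ}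

lemma curveSymm_eq (hφ : IsCurveChart s φ) {p : Curve} (hp : p ∈ φ.source) :
    (curveSymm s p).1 = ((φ p : OnePoint ℂ),
      (affineCoord (curveSymm s p).1.2 : OnePoint ℂ)) ∧ affineCoord (curveSymm s p).1.2 ≠ 0 := by
  obtain ⟨b, hb, hb'⟩ := hφ.snd_eq p hp
  rw [hb', affineCoord_coe]
  exact ⟨Prod.ext (hφ.fst_eq p hp) hb', hb⟩

lemma curve_eq (hφ : IsCurveChart s φ) {p : Curve} (hp : p ∈ φ.source) :
    affineCoord (curveSymm s p).1.2 ^ 3 * (φ p ^ 3 - 1) = φ p ^ 3 + 1 := by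
  have h := (curveSymm s p).2
  rw [(hφ.curveSymm_eq hp).1] at h
  exact coe_mem_curve_iff.1 h

lemma formCoeff_eq (hφ : IsCurveChart s φ) {p : Curve} (hp : p ∈ φ.source) (i : Bool) :
    formCoeff i s p = formFactor i s (φ p) (affineCoord (curveSymm s p).1.2) *
      baseCoeff (φ p) (affineCoord (curveSymm s p).1.2) := by
  rw [formCoeff, hφ.fst_eq p hp, affineCoord_coe]

lemma differentiableOn_formCoeff (hφ : IsCurveChart s φ) (i : Bool) :
    DifferentiableOn ℂ (fun z => formCoeff i s (φ.symm z)) φ.target := by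
  set b : ℂ → ℂ := fun z => affineCoord (curveSymm s (φ.symm z)).1.2 with hb
  have hd : DifferentiableOn ℂ b φ.target := hφ.differentiableOn_snd
  have h1 : DifferentiableOn ℂ (fun z => formFactor i s z (b z)) φ.target := by
    rcases s with ⟨_ | _, _ | _⟩ <;> cases i <;> simp only [formFactor] <;> fun_prop
  have h2 : DifferentiableOn ℂ (fun z => baseCoeff z (b z)) φ.target := by
    refine DifferentiableOn.inv (by fun_prop) fun z hz => ?_
    have hp := φ.map_target hz
    have h := hφ.curve_eq hp
    rw [φ.right_inv hz] at h
    exact mul_ne_zero (pow_ne_zero 2 (hφ.curveSymm_eq hp).2) (cube_sub_one_ne_zero h)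
  refine (h1.mul h2).congr fun z hz => ?_
  rw [hφ.formCoeff_eq (φ.map_target hz), φ.right_inv hz]
  rfl

/-- Transition functions are holomorphic, and the coefficients of the two forms transform as those
of one-forms. -/
lemma exists_hasDerivAt_transition (hφ : IsCurveChart s φ) (hψ : IsCurveChart t ψ) {z : ℂ}
    (hz : z ∈ φ.target) (hz' : φ.symm z ∈ ψ.source) :
    ∃ c', HasDerivAt (fun w => ψ (φ.symm w)) c' z ∧
      ∀ i, c' * formCoeff i t (φ.symm z) = formCoeff i s (φ.symm z) := by
  set b : ℂ → ℂ := fun z => affineCoord (curveSymm s (φ.symm z)).1.2 with hb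
  set d : ℂ → ℂ := fun z => affineCoord (curveSymm t (φ.symm z)).1.2 with hd
  have hnhds : φ.target ∈ nhds z := φ.open_target.mem_nhds hz
  have hcurve : ∀ w ∈ φ.target, b w ^ 3 * (w ^ 3 - 1) = w ^ 3 + 1 := by
    intro w hw
    have h := hφ.curve_eq (φ.map_target hw)
    rwa [φ.right_inv hw] at h
  have hb0 : b z ≠ 0 := (hφ.curveSymm_eq (φ.map_target hz)).2
  have hbd : HasDerivAt b (deriv b z) z :=
    (hφ.differentiableOn_snd.differentiableAt hnhds).hasDerivAt
  -- Differentiate the equation of the curve.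
  have hY : deriv b z * (b z ^ 2 * (z ^ 3 - 1)) = -z ^ 2 * (b z ^ 3 - 1) := by
    have e1 := (hbd.fun_pow 3).fun_mul ((hasDerivAt_pow 3 z).sub_const 1)
    have e2 := ((hasDerivAt_pow 3 z).add_const 1).congr_of_eventuallyEq
      (Filter.eventually_of_mem hnhds hcurve)
    have e3 := e1.unique e2
    norm_num at e3
    linear_combination e3 / 3
  have hrel : ∀ w ∈ φ.target, φ.symm w ∈ ψ.source →
      (coordChange s t).Rel w (b w) (ψ (φ.symm w)) (d w) := by
    intro w hw hw'
    have h1 := (hφ.curveSymm_eq (φ.map_target hw)).1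
    rw [φ.right_inv hw] at h1
    exact coordChange_rel s t h1 (hψ.curveSymm_eq hw').1
  have hev : ∀ᶠ w in nhds z, (coordChange s t).Rel w (b w) (ψ (φ.symm w)) (d w) := by
    filter_upwards [hnhds, (φ.continuousAt_symm hz).preimage_mem_nhds
      (ψ.open_source.mem_nhds hz')] with w hw hw' using hrel w hw hw'
  obtain ⟨c', hc', he⟩ := (coordChange s t).exists_hasDerivAt hev hbd hb0
    (hψ.curveSymm_eq hz').2 (hcurve z hz) hY
  refine ⟨c', hc', fun i => ?_⟩
  have hf := coordChange_factor s t (hrel z hz hz') i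
  rw [hψ.formCoeff_eq hz', hφ.formCoeff_eq (φ.map_target hz), φ.right_inv hz, mul_left_comm,
    he, ← hf]
  ring

end IsCurveChart

instance : IsManifold 𝓘(ℂ, ℂ) ω Curve := by
  refine isManifold_of_contDiffOn _ _ _ ?_
  rintro φ ψ ⟨s, hφ⟩ ⟨t, hψ⟩
  have h : DifferentiableOn ℂ (φ.symm ≫ₕ ψ) (φ.symm ≫ₕ ψ).source := by
    intro z hz
    rw [OpenPartialHomeomorph.trans_source] at hz
    obtain ⟨c', hc', -⟩ := hφ.exists_hasDerivAt_transition hψ hz.1 hz.2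
    exact hc'.differentiableAt.differentiableWithinAt
  simpa using h.contDiffOn (φ.symm ≫ₕ ψ).open_source

/-- The type of the preferred chart at a point. -/
def chartType (p : Curve) : Bool × Bool := (exists_curveChart p).choose_spec.2.choose

lemma isCurveChart_chartAt (p : Curve) : IsCurveChart (chartType p) (chartAt ℂ p) :=
  (exists_curveChart p).choose_spec.2.choose_spec

/-- The form `dx/(y² (x³ - 1))` or `x dx/(y² (x³ - 1))` on the curve. Tangent vectors at `p` are
numbers by means of the preferred chart at `p`. -/
def curveForm (i : Bool) (p : Curve) : TangentSpace 𝓘(ℂ, ℂ) p →ₗ[ℂ] ℂ :=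
  (LinearMap.lsmul ℂ ℂ (formCoeff i (chartType p) p) : ℂ →ₗ[ℂ] ℂ)

lemma chartCoeff_curveForm (i : Bool) (p : Curve) (v : ℂ) {z : ℂ}
    (hz : z ∈ (chartAt ℂ p).target) :
    chartCoeff 𝓘(ℂ, ℂ) (fun q v => curveForm i q v) p v z
      = formCoeff i (chartType p) ((chartAt ℂ p).symm z) * v := by
  obtain ⟨c', hc', he⟩ := (isCurveChart_chartAt p).exists_hasDerivAt_transition
    (isCurveChart_chartAt ((chartAt ℂ p).symm z)) hz (mem_chart_source ℂ _)
  have hm : HasMFDerivAt 𝓘(ℂ, ℂ) 𝓘(ℂ, ℂ) (extChartAt 𝓘(ℂ, ℂ) p).symm z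
      (ContinuousLinearMap.toSpanSingleton ℂ c') := by
    refine ⟨?_, ?_⟩
    · have h := (chartAt ℂ p).continuousAt_symm hz
      simpa using h
    · simp only [writtenInExtChartAt, Function.comp_def, mfld_simps]
      exact hc'.hasFDerivAt.hasFDerivWithinAt
  have hv : (mfderiv 𝓘(ℂ, ℂ) 𝓘(ℂ, ℂ) (extChartAt 𝓘(ℂ, ℂ) p).symm z v : ℂ) = v * c' := by
    rw [hm.mfderiv]
    rfl
  rw [← he i]
  have h := congrArg (fun w : ℂ => formCoeff i (chartType ((chartAt ℂ p).symm z))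
    ((chartAt ℂ p).symm z) * w) hv
  refine Eq.trans h ?_
  ring

lemma curveForm_mem (i : Bool) : curveForm i ∈ holOneForms 𝓘(ℂ, ℂ) Curve := by
  intro p v
  simp only [preimage_univ, inter_univ]
  have ht : (extChartAt 𝓘(ℂ, ℂ) p).target = (chartAt ℂ p).target := by simp
  rw [ht]
  exact (((isCurveChart_chartAt p).differentiableOn_formCoeff i).mul_const v).congr
    fun z hz => chartCoeff_curveForm i p v hz

end Charts

/-! ### The genus of the curve -/

section Genus

/-- A linear relation between the two forms is a linear equation for the coordinate `x` of the
points of the affine curve. -/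
lemma add_mul_eq_zero_of_curveForm {r₀ r₁ : ℂ}
    (h : r₀ • curveForm false + r₁ • curveForm true = 0) {a b : ℂ} (hb : b ≠ 0)
    (hab : b ^ 3 * (a ^ 3 - 1) = a ^ 3 + 1) : r₀ + r₁ * a = 0 := by
  obtain ⟨φ, hφ, hmem⟩ := exists_affine_chart a hb
  let p : Curve := ⟨((a : OnePoint ℂ), (b : OnePoint ℂ)), coe_mem_curve_iff.2 hab⟩
  have hp : p ∈ φ.source := hmem p rfl
  have hl : φ.symm (φ p) = p := φ.left_inv hp
  obtain ⟨c', -, hc'⟩ := hφ.exists_hasDerivAt_transition (isCurveChart_chartAt p)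
    (φ.map_source hp) (by rw [hl]; exact mem_chart_source ℂ p)
  simp only [hl] at hc'
  have e0 : formCoeff false (false, false) p = baseCoeff a b := one_mul _
  have e1 : formCoeff true (false, false) p = a * baseCoeff a b := rfl
  have hrel : r₀ * formCoeff false (chartType p) p + r₁ * formCoeff true (chartType p) p = 0 := by
    have h1 := LinearMap.congr_fun (congrFun h p) (1 : ℂ)
    refine Eq.trans ?_ h1
    change _ = r₀ * (formCoeff false (chartType p) p * 1)
      + r₁ * (formCoeff true (chartType p) p * 1)
    rw [mul_one, mul_one]
  have hne : baseCoeff a b ≠ 0 :=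
    inv_ne_zero (mul_ne_zero (pow_ne_zero 2 hb) (cube_sub_one_ne_zero hab))
  apply mul_right_cancel₀ hne
  linear_combination c' * hrel - r₀ * hc' false - r₁ * hc' true - r₀ * e0 - r₁ * e1

lemma two_le_genus_curve : 2 ≤ genus Curve := by
  have hli : LinearIndependent ℂ ![(⟨curveForm false, curveForm_mem false⟩ :
      holOneForms 𝓘(ℂ, ℂ) Curve), ⟨curveForm true, curveForm_mem true⟩] := by
    rw [LinearIndependent.pair_iff]
    intro r₀ r₁ h
    have h' : r₀ • curveForm false + r₁ • curveForm true = 0 := congrArg Subtype.val h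
    have h0 := add_mul_eq_zero_of_curveForm h' (a := 0) (b := -1) (by norm_num) (by norm_num)
    obtain ⟨b, hb⟩ := IsAlgClosed.exists_pow_nat_eq (9 / 7 : ℂ) (n := 3) (by norm_num)
    -- The points of the curve over `x = 2` have `y³ = 9/7`.
    have h2 := add_mul_eq_zero_of_curveForm h' (a := 2) (b := b)
      (by rintro rfl; norm_num at hb) (by rw [hb]; norm_num)
    have hr₀ : r₀ = 0 := by linear_combination h0
    exact ⟨hr₀, by linear_combination (h2 - hr₀) / 2⟩
  rw [genus]
  simpa using hli.cardinal_le_rank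

end Genus

/-! ### Existence -/

section Existence


variable {Y : Type u} [TopologicalSpace Y] [ChartedSpace ℂ Y]

lemma exists_linearIndependent_forms (h : 2 ≤ genus Y) :
    ∃ α₁ α₂ : holOneForms 𝓘(ℂ, ℂ) Y, LinearIndependent ℂ ![α₁, α₂] := by
  have h1 : 1 < Module.rank ℂ (holOneForms 𝓘(ℂ, ℂ) Y) := lt_of_lt_of_le (by norm_num) h
  obtain ⟨α₁, hα₁⟩ := (rank_pos_iff_exists_ne_zero (R := ℂ)).1 (zero_lt_one.trans h1)
  obtain ⟨α₂, h2⟩ := exists_linearIndependent_pair_of_one_lt_rank h1 hα₁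
  exact ⟨α₁, α₂, h2⟩

lemma exists_branchedProjectiveStructure_prod [IsManifold 𝓘(ℂ, ℂ) ω Y]
    [CompactSpace Y] [T2Space Y] [ConnectedSpace Y] (h : 2 ≤ genus Y) :
    ∃ (X : Type u) (_ : TopologicalSpace X) (_ : ChartedSpace (ℂ × ℂ) X)
      (_ : IsManifold 𝓘(ℂ, ℂ × ℂ) ω X) (_ : CompactSpace X) (_ : T2Space X)
      (_ : ConnectedSpace X) (S : BranchedProjectiveStructure 𝓘(ℂ, ℂ × ℂ) X 2),
      S.geometry.IsNormal ∧ ¬ S.geometry.IsFlat := by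
  obtain ⟨α₁, α₂, hα⟩ := exists_linearIndependent_forms h
  have n₁ : α₁.1 ≠ 0 := fun h0 => hα.ne_zero 0 (Subtype.ext h0)
  have n₂ : α₂.1 ≠ 0 := fun h0 => hα.ne_zero 1 (Subtype.ext h0)
  -- The trivial model on `ℂ × ℂ` equals the product model, but only propositionally.
  have key : ∀ I : ModelWithCorners ℂ (ℂ × ℂ) (ModelProd ℂ ℂ), I = 𝓘(ℂ, ℂ).prod 𝓘(ℂ, ℂ) →
      ∃ (_ : IsManifold I ω (Y × Y)) (S : BranchedProjectiveStructure I (Y × Y) 2),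
        S.geometry.IsNormal ∧ ¬ S.geometry.IsFlat := by
    rintro I rfl
    exact ⟨inferInstance, ⟨_, productGeometry α₁.2 α₂.2 n₁ n₂⟩,
      productGeometry_isNormal α₁.2 α₂.2 n₁ n₂, productGeometry_not_isFlat α₁.2 α₂.2 n₁ n₂⟩
  obtain ⟨hm, S, hS⟩ := key 𝓘(ℂ, ℂ × ℂ) modelWithCornersSelf_prod
  exact ⟨Y × Y, inferInstance, prodChartedSpace ℂ Y ℂ Y, hm, inferInstance, inferInstance,
    inferInstance, S, hS⟩

end Existence

end BranchedCartan

end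

open BranchedCartan in
theorem proposition3p4 :
    -- existence on some compact complex surface
    (∃ (X : Type) (_ : TopologicalSpace X) (_ : ChartedSpace (ℂ × ℂ) X)
        (_ : IsManifold 𝓘(ℂ, ℂ × ℂ) ω X) (_ : CompactSpace X) (_ : T2Space X)
        (_ : ConnectedSpace X) (S : BranchedProjectiveStructure 𝓘(ℂ, ℂ × ℂ) X 2),
        S.geometry.IsNormal ∧ ¬ S.geometry.IsFlat) ∧
    -- compact Riemann surfaces of genus at least two exist
    (∃ (Y : Type) (_ : TopologicalSpace Y) (_ : ChartedSpace ℂ Y)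
        (_ : IsManifold 𝓘(ℂ, ℂ) ω Y) (_ : CompactSpace Y) (_ : T2Space Y)
        (_ : ConnectedSpace Y), 2 ≤ genus Y) ∧
    -- on `Y × Y`, every independent pair of holomorphic forms gives an explicit example
    (∀ (Y : Type*) [TopologicalSpace Y] [ChartedSpace ℂ Y] [IsManifold 𝓘(ℂ, ℂ) ω Y]
        [CompactSpace Y] [T2Space Y] [ConnectedSpace Y], 2 ≤ genus Y →
      (∃ α₁ α₂ : holOneForms 𝓘(ℂ, ℂ) Y, LinearIndependent ℂ ![α₁, α₂]) ∧
      ∀ α₁ α₂ : holOneForms 𝓘(ℂ, ℂ) Y, LinearIndependent ℂ ![α₁, α₂] →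
        ∃ Θ : BranchedGeometry (𝓘(ℂ, ℂ).prod 𝓘(ℂ, ℂ))
            (trivialBundle (𝓘(ℂ, ℂ).prod 𝓘(ℂ, ℂ)) (Y × Y) 2),
          (∀ i x w v, (Θ.θ i x (w, v) : Matrix (Fin 3) (Fin 3) ℂ)
            = (w : Matrix (Fin 3) (Fin 3) ℂ) + productForm α₁.1 α₂.1 x v) ∧
          Θ.IsNormal ∧ ¬ Θ.IsFlat) := by
  refine ⟨exists_branchedProjectiveStructure_prod two_le_genus_curve,
    ⟨Curve, inferInstance, inferInstance, inferInstance, inferInstance, inferInstance,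
      inferInstance, two_le_genus_curve⟩, ?_⟩
  intro Y _ _ _ _ _ _ h
  refine ⟨exists_linearIndependent_forms h, fun α₁ α₂ hα => ?_⟩
  have n₁ : α₁.1 ≠ 0 := fun h0 => hα.ne_zero 0 (Subtype.ext h0)
  have n₂ : α₂.1 ≠ 0 := fun h0 => hα.ne_zero 1 (Subtype.ext h0)
  exact ⟨productGeometry α₁.2 α₂.2 n₁ n₂, fun _ x w v => productTheta_apply α₁.1 α₂.1 x w v,
    productGeometry_isNormal α₁.2 α₂.2 n₁ n₂, productGeometry_not_isFlat α₁.2 α₂.2 n₁ n₂⟩
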